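/- Let $k$ be a field. Dgas are $\mathbb{Z}$-graded and cohomologically graded, and all duals and tensor products are over $k$. Let $E$ be an augmented dga over $k$ which is $1$-coconnective (that is, $E^i=0$ for $i<0$ and $E^0\cong k$) and locally finite (each $E^i$ is finite-dimensional). Its graded linear dual $E^*$, with $(E^*)^{n}=(E^{-n})^*$, is then a coaugmented dg coalgebra. Let $\overline{E^*}$ be its coaugmentation coideal (the kernel of the counit), and let $\Omega(E^*)$ be the cobar construction: the augmented dga whose underlying graded algebra is the tensor algebra $T(\overline{E^*}[-1])$, with differential the derivation induced by the differential and the reduced comultiplication of $\overline{E^*}$. Let $\widehat{\Omega}(E^*)$ be the completed cobar construction, i.e. the completion of $\Omega(E^*)$ along its augmentation ideal $\mathfrak m$ taken degree by degree, $\widehat{\Omega}(E^*)^i=\varprojlim_n \left(\Omega(E^*)/\mathfrak m^n\right)^i$; its underlying graded algebra is the completed tensor algebra on $\overline{E^*}[-1]$. Suppose that the augmented algebra $H^0(\Omega(E^*))$ is nilpotent, meaning that its augmentation ideal $I$ satisfies $I^N=0$ for some $N$. Then the completion map $c\colon \Omega(E^*)\to\widehat{\Omega}(E^*)$ is a quasi-isomorphism.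 -/

import Mathlib

open CategoryTheory
open scoped TensorProduct DirectSum

universe u v w

namespace CobarCompletion

/-! ### Gradings -/

section Grading

variable {k : Type u} [Field k] {M : Type v} [AddCommGroup M] [Module k M]
  {N : Type w} [AddCommMonoid N] [Module k N] {gr : ℤ → Submodule k M}

/-- The linear map out of an internally graded space that is given by `f i` in degree `i`. -/
noncomputable def gradedLift (h : DirectSum.IsInternal gr) (f : ∀ i, gr i →ₗ[k] N) : M →ₗ[k] N :=
  DirectSum.toModule k ℤ N f ∘ₗ
    (LinearEquiv.ofBijective (DirectSum.coeLinearMap gr) h).symm.toLinearMap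

theorem gradedLift_of_mem (h : DirectSum.IsInternal gr) (f : ∀ i, gr i →ₗ[k] N) {i : ℤ} {x : M}
    (hx : x ∈ gr i) : gradedLift h f x = f i ⟨x, hx⟩ := by
  have : (LinearEquiv.ofBijective (DirectSum.coeLinearMap gr) h).symm x
      = DirectSum.lof k ℤ (fun i => gr i) i ⟨x, hx⟩ := by
    rw [LinearEquiv.symm_apply_eq]
    exact (DirectSum.coeLinearMap_lof gr i ⟨x, hx⟩).symm
  simp [gradedLift, this]

/-- The Koszul sign operator: multiplication by `(-1) ^ i` in degree `i`. -/
noncomputable def gradedSign (h : DirectSum.IsInternal gr) : M →ₗ[k] M :=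
  gradedLift h fun i => (-1 : k) ^ i • (gr i).subtype

theorem gradedSign_of_mem (h : DirectSum.IsInternal gr) {i : ℤ} {x : M} (hx : x ∈ gr i) :
    gradedSign h x = (-1 : k) ^ i • x := by
  simp [gradedSign, gradedLift_of_mem h _ hx]

/-- The projection onto the component of degree `i`. -/
noncomputable def gradedProj (h : DirectSum.IsInternal gr) (i : ℤ) : M →ₗ[k] gr i :=
  gradedLift h fun j => if e : j = i then
    (LinearEquiv.ofEq (gr j) (gr i) (by rw [e])).toLinearMap else 0

theorem gradedProj_same (h : DirectSum.IsInternal gr) {i : ℤ} {x : M} (hx : x ∈ gr i) :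
    gradedProj h i x = ⟨x, hx⟩ := by
  simp only [gradedProj, gradedLift_of_mem h _ hx]
  rfl

theorem gradedProj_ne (h : DirectSum.IsInternal gr) {i j : ℤ} (hij : j ≠ i) {x : M}
    (hx : x ∈ gr j) : gradedProj h i x = 0 := by
  simp [gradedProj, gradedLift_of_mem h _ hx, hij]

theorem graded_induction (h : DirectSum.IsInternal gr) {P : M → Prop}
    (h0 : P 0) (hadd : ∀ x y, P x → P y → P (x + y)) (hmem : ∀ i, ∀ x ∈ gr i, P x) (x : M) :
    P x := by
  have hx : x ∈ ⨆ i, gr i := by rw [h.submodule_iSup_eq_top]; trivial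
  exact Submodule.iSup_induction gr (motive := P) hx hmem h0 hadd

theorem graded_ext (h : DirectSum.IsInternal gr) {f g : M →ₗ[k] N}
    (hfg : ∀ i, ∀ x ∈ gr i, f x = g x) : f = g := by
  ext x
  induction x using graded_induction h with
  | h0 => simp
  | hadd x y hx hy => simp [hx, hy]
  | hmem i x hx => exact hfg i x hx

theorem neg_one_zpow_mul_self (i : ℤ) : (-1 : k) ^ i * (-1 : k) ^ i = 1 := by
  rw [← mul_zpow]; simp

theorem neg_one_zpow_succ (i : ℤ) : (-1 : k) ^ (i + 1) = -(-1 : k) ^ i := by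
  rw [zpow_add_one₀ (by simp)]; simp

theorem gradedSign_gradedSign (h : DirectSum.IsInternal gr) (x : M) :
    gradedSign h (gradedSign h x) = x := by
  have : gradedSign h ∘ₗ gradedSign h = LinearMap.id := graded_ext h fun i x hx => by
    simp [gradedSign_of_mem h hx, smul_smul, neg_one_zpow_mul_self]
  exact LinearMap.congr_fun this x

end Grading

/-! ### Augmented dg algebras -/

/-- An augmented differential graded algebra over `k` (cohomological grading), written as an
internally `ℤ`-graded algebra with a differential of degree `1` and an augmentation, which is a
morphism of dg algebras to `k`. -/
structure AugDGA (k : Type u) [Field k] where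
  /-- the underlying space, the direct sum of all the graded pieces -/
  carrier : Type v
  [ring : Ring carrier]
  [algebra : Algebra k carrier]
  /-- the graded pieces -/
  gr : ℤ → Submodule k carrier
  gr_internal : DirectSum.IsInternal gr
  one_mem : 1 ∈ gr 0
  mul_mem : ∀ i j a b, a ∈ gr i → b ∈ gr j → a * b ∈ gr (i + j)
  /-- the differential -/
  d : carrier →ₗ[k] carrier
  d_mem : ∀ i a, a ∈ gr i → d a ∈ gr (i + 1)
  d_d : ∀ a, d (d a) = 0
  leibniz : ∀ i a b, a ∈ gr i → d (a * b) = d a * b + (-1 : k) ^ i • (a * d b)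
  /-- the augmentation -/
  aug : carrier →ₐ[k] k
  aug_gr : ∀ i, i ≠ 0 → ∀ a ∈ gr i, aug a = 0
  aug_d : ∀ a, aug (d a) = 0

attribute [instance] AugDGA.ring AugDGA.algebra

/-- A coaugmented differential graded coalgebra over `k`: an internally `ℤ`-graded counital
coassociative coalgebra with a differential of degree `1` which is a coderivation, and a
coaugmentation `k → C`, given by the image `unit` of `1`. -/
structure CoaugDGC (k : Type u) [Field k] where
  /-- the underlying space, the direct sum of all the graded pieces -/
  carrier : Type v
  [addCommGroup : AddCommGroup carrier]
  [module : Module k carrier]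
  [coalgebra : Coalgebra k carrier]
  /-- the graded pieces -/
  gr : ℤ → Submodule k carrier
  gr_internal : DirectSum.IsInternal gr
  counit_gr : ∀ i, i ≠ 0 → ∀ c ∈ gr i, Coalgebra.counit (R := k) c = 0
  comul_gr : ∀ n, ∀ c ∈ gr n, Coalgebra.comul (R := k) c ∈
    ⨆ p : ℤ, LinearMap.range (TensorProduct.mapIncl (gr p) (gr (n - p)))
  /-- the differential -/
  d : carrier →ₗ[k] carrier
  d_mem : ∀ i c, c ∈ gr i → d c ∈ gr (i + 1)
  d_d : ∀ c, d (d c) = 0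
  counit_d : ∀ c, Coalgebra.counit (R := k) (d c) = 0
  comul_d : ∀ c, Coalgebra.comul (R := k) (d c) =
    TensorProduct.map d LinearMap.id (Coalgebra.comul (R := k) c) +
      TensorProduct.map (gradedSign gr_internal) d (Coalgebra.comul (R := k) c)
  /-- the image of `1` under the coaugmentation -/
  unit : carrier
  unit_mem : unit ∈ gr 0
  counit_unit : Coalgebra.counit (R := k) unit = 1
  comul_unit : Coalgebra.comul (R := k) unit = unit ⊗ₜ[k] unit
  d_unit : d unit = 0

attribute [instance] CoaugDGC.addCommGroup CoaugDGC.module CoaugDGC.coalgebra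

namespace AugDGA

variable {k : Type u} [Field k] (A : AugDGA.{u, v} k)

/-- Every graded piece is finite-dimensional. -/
def IsLocallyFinite : Prop := ∀ i, Module.Finite k (A.gr i)

/-- `A` is coconnective, that is zero in negative degrees, and `A⁰ ≅ k`. -/
def IsOneCoconnective : Prop := (∀ i, i < 0 → A.gr i = ⊥) ∧ Nonempty (A.gr 0 ≃ₗ[k] k)

/-- `A` is locally finite, and bounded above or bounded below. -/
def IsRaylike : Prop :=
  A.IsLocallyFinite ∧ ((∃ b, ∀ i, b < i → A.gr i = ⊥) ∨ (∃ b, ∀ i, i < b → A.gr i = ⊥))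

variable {A} in
theorem IsOneCoconnective.isRaylike (h : A.IsOneCoconnective) (hf : A.IsLocallyFinite) :
    A.IsRaylike := ⟨hf, Or.inr ⟨0, h.1⟩⟩

/-! ### Cohomology in degree zero -/

/-- The algebra `Z⁰(A)` of cocycles of degree `0`. -/
def cocycles₀ : Subalgebra k A.carrier where
  carrier := {a | a ∈ A.gr 0 ∧ A.d a = 0}
  mul_mem' := by
    rintro a b ⟨ha, ha'⟩ ⟨hb, hb'⟩
    exact ⟨by simpa using A.mul_mem 0 0 a b ha hb, by simp [A.leibniz 0 a b ha, ha', hb']⟩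
  add_mem' := by
    rintro a b ⟨ha, ha'⟩ ⟨hb, hb'⟩
    exact ⟨add_mem ha hb, by simp [ha', hb']⟩
  algebraMap_mem' := by
    intro r
    have h1 : A.d 1 = 0 := by
      have := A.leibniz 0 1 1 A.one_mem
      simpa using this
    rw [Algebra.algebraMap_eq_smul_one]
    exact ⟨(A.gr 0).smul_mem r A.one_mem, by simp [h1]⟩

/-- The ideal `B⁰(A) = d(A⁻¹)` of `Z⁰(A)`. -/
def coboundaries₀ : Ideal A.cocycles₀ where
  carrier := {z | ∃ b ∈ A.gr (-1), A.d b = z}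
  add_mem' := by
    rintro _ _ ⟨a, ha, ha'⟩ ⟨b, hb, hb'⟩
    exact ⟨a + b, add_mem ha hb, by simp [ha', hb']⟩
  zero_mem' := ⟨0, zero_mem _, by simp⟩
  smul_mem' := by
    rintro ⟨z, hz, hz'⟩ _ ⟨b, hb, hb'⟩
    exact ⟨z * b, by simpa using A.mul_mem 0 (-1) z b hz hb, by simp [A.leibniz 0 z b hz, hz', hb']⟩

instance : A.coboundaries₀.IsTwoSided where
  mul_mem_of_left := by
    rintro _ ⟨z, hz, hz'⟩ ⟨b, hb, hb'⟩
    exact ⟨b * z, by simpa using A.mul_mem (-1) 0 b z hb hz, by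
      simp [A.leibniz (-1) b z hb, hz', hb']⟩

/-- The `k`-algebra `H⁰(A)`. -/
abbrev H₀ : Type v := A.cocycles₀ ⧸ A.coboundaries₀

/-- The augmentation that `H⁰(A)` inherits from `A`. -/
noncomputable def H₀aug : A.H₀ →ₐ[k] k :=
  Ideal.Quotient.liftₐ A.coboundaries₀ (A.aug.comp A.cocycles₀.val) (by
    rintro z ⟨b, -, hb'⟩
    change A.aug z = 0
    rw [← hb']
    exact A.aug_d b)

/-- The augmented algebra `H⁰(A)` is nilpotent: its augmentation ideal `I` satisfies `Iⁿ = 0` for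
some `n`. -/
def IsH₀Nilpotent : Prop :=
  ∃ n : ℕ, (LinearMap.ker A.H₀aug.toLinearMap) ^ n = (⊥ : Submodule k A.H₀)

/-! ### The underlying complex and the completion -/

/-- The differential `Aⁱ → Aʲ`, where `j = i + 1`. -/
def dRes (i j : ℤ) (h : i + 1 = j) : A.gr i →ₗ[k] A.gr j :=
  A.d.restrict fun a ha => h ▸ A.d_mem i a ha

/-- The underlying cochain complex of `A`. -/
noncomputable def complex : CochainComplex (ModuleCat.{v} k) ℤ where
  X i := ModuleCat.of k (A.gr i)
  d i j := if h : i + 1 = j then ModuleCat.ofHom (A.dRes i j h) else 0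
  shape i j h := dif_neg h
  d_comp_d' := by
    rintro i j l (hij : i + 1 = j) (hjl : j + 1 = l)
    rw [dif_pos hij, dif_pos hjl]
    ext x
    exact A.d_d x.1

/-- The power `𝔪ⁿ⁺¹` of the augmentation ideal `𝔪` of `A`. -/
def augPow (n : ℕ) : Submodule k A.carrier := (LinearMap.ker A.aug.toLinearMap) ^ (n + 1)

theorem augPow_succ_le (n : ℕ) : A.augPow (n + 1) ≤ A.augPow n := by
  have h : LinearMap.ker A.aug.toLinearMap * LinearMap.ker A.aug.toLinearMap ≤
      LinearMap.ker A.aug.toLinearMap := by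
    rw [Submodule.mul_le]
    intro a ha b hb
    simp only [LinearMap.mem_ker, AlgHom.toLinearMap_apply] at *
    simp [ha]
  unfold augPow
  rw [pow_succ, pow_succ, mul_assoc]
  exact mul_le_mul_right h _

theorem d_mem_augPow (n : ℕ) : ∀ a ∈ A.augPow n, A.d a ∈ A.augPow n := by
  have hs : ∀ a, a ∈ LinearMap.ker A.aug.toLinearMap →
      gradedSign A.gr_internal a ∈ LinearMap.ker A.aug.toLinearMap := by
    have : A.aug.toLinearMap ∘ₗ gradedSign A.gr_internal = A.aug.toLinearMap := by
      refine graded_ext A.gr_internal fun i x hx => ?_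
      rcases eq_or_ne i 0 with rfl | hi
      · simp [gradedSign_of_mem A.gr_internal hx]
      · simp [gradedSign_of_mem A.gr_internal hx, A.aug_gr i hi x hx]
    intro a ha
    rw [LinearMap.mem_ker] at *
    rw [← ha]
    exact LinearMap.congr_fun this a
  have hl : ∀ a b, A.d (a * b) = A.d a * b + gradedSign A.gr_internal a * A.d b := by
    intro a b
    induction a using graded_induction A.gr_internal with
    | h0 => simp
    | hadd x y hx hy => simp only [add_mul, map_add, hx, hy]; abel
    | hmem i x hx => simp [A.leibniz i x b hx, gradedSign_of_mem A.gr_internal hx]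
  have hd : ∀ a, A.d a ∈ LinearMap.ker A.aug.toLinearMap := fun a => by
    simpa using A.aug_d a
  induction n with
  | zero =>
    intro a _
    simpa [augPow] using A.aug_d a
  | succ n ih =>
    intro a ha
    unfold augPow at ha ih ⊢
    rw [pow_succ'] at ha ⊢
    induction ha using Submodule.mul_induction_on' with
    | mem_mul_mem x hx y hy =>
      rw [hl]
      exact add_mem (Submodule.mul_mem_mul (hd x) hy) (Submodule.mul_mem_mul (hs x hx) (ih y hy))
    | add x _ y _ hx hy => rw [map_add]; exact add_mem hx hy

/-- The degree `i` part of `A / 𝔪ⁿ⁺¹`. -/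
def quot (n : ℕ) (i : ℤ) : Type v := A.gr i ⧸ (A.augPow n).submoduleOf (A.gr i)

instance (n : ℕ) (i : ℤ) : AddCommGroup (A.quot n i) :=
  inferInstanceAs (AddCommGroup (A.gr i ⧸ (A.augPow n).submoduleOf (A.gr i)))

instance (n : ℕ) (i : ℤ) : Module k (A.quot n i) :=
  inferInstanceAs (Module k (A.gr i ⧸ (A.augPow n).submoduleOf (A.gr i)))

/-- The quotient map `Aⁱ → (A / 𝔪ⁿ⁺¹)ⁱ`. -/
def quotMk (n : ℕ) (i : ℤ) : A.gr i →ₗ[k] A.quot n i :=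
  ((A.augPow n).submoduleOf (A.gr i)).mkQ

theorem quotMk_surjective (n : ℕ) (i : ℤ) : Function.Surjective (A.quotMk n i) :=
  Submodule.mkQ_surjective _

/-- The transition map `(A / 𝔪ⁿ⁺²)ⁱ → (A / 𝔪ⁿ⁺¹)ⁱ`. -/
def quotTransition (n : ℕ) (i : ℤ) : A.quot (n + 1) i →ₗ[k] A.quot n i :=
  Submodule.factor (Submodule.comap_mono (A.augPow_succ_le n))

/-- The differential `(A / 𝔪ⁿ⁺¹)ⁱ → (A / 𝔪ⁿ⁺¹)ʲ`, where `j = i + 1`. -/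
def quotD (n : ℕ) (i j : ℤ) (h : i + 1 = j) : A.quot n i →ₗ[k] A.quot n j :=
  Submodule.mapQ _ _ (A.dRes i j h) fun a ha => A.d_mem_augPow n a ha

/-- The degree `i` part of the completion of `A` along its augmentation ideal `𝔪`: the inverse
limit over `n` of the spaces `(A / 𝔪ⁿ⁺¹)ⁱ`. -/
def completionGr (i : ℤ) : Submodule k (∀ n, A.quot n i) where
  carrier := {x | ∀ n, A.quotTransition n i (x (n + 1)) = x n}
  add_mem' := by
    intro x y hx hy n
    simp [hx n, hy n]
  zero_mem' := by intro n; simp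
  smul_mem' := by
    intro r x hx n
    simp [hx n]



theorem quotTransition_quotD (n : ℕ) (i j : ℤ) (h : i + 1 = j) (x : A.quot (n + 1) i) :
    A.quotTransition n j (A.quotD (n + 1) i j h x) = A.quotD n i j h (A.quotTransition n i x) := by
  obtain ⟨a, rfl⟩ := A.quotMk_surjective _ _ x
  rfl

/-- The differential of the completion, induced by that of `A`. -/
def completionD (i j : ℤ) (h : i + 1 = j) : A.completionGr i →ₗ[k] A.completionGr j :=
  (LinearMap.pi fun n => A.quotD n i j h ∘ₗ LinearMap.proj n).restrict fun x hx n => by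
    simp [quotTransition_quotD, hx n]

/-- The underlying cochain complex of the completion of `A` along its augmentation ideal. -/
noncomputable def completion : CochainComplex (ModuleCat.{v} k) ℤ where
  X i := ModuleCat.of k (A.completionGr i)
  d i j := if h : i + 1 = j then ModuleCat.ofHom (A.completionD i j h) else 0
  shape i j h := dif_neg h
  d_comp_d' := by
    rintro i j l (hij : i + 1 = j) (hjl : j + 1 = l)
    rw [dif_pos hij, dif_pos hjl]
    ext x n
    change A.quotD n j l hjl (A.quotD n i j hij (x.1 n)) = 0
    obtain ⟨a, ha⟩ := A.quotMk_surjective _ _ (x.1 n)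
    rw [← ha]
    change A.quotMk n l (A.dRes j l hjl (A.dRes i j hij a)) = _
    have : A.dRes j l hjl (A.dRes i j hij a) = 0 := Subtype.ext (A.d_d a)
    rw [this, map_zero]

/-- The completion map, in degree `i`. -/
def completionMapGr (i : ℤ) : A.gr i →ₗ[k] A.completionGr i :=
  (LinearMap.pi fun n => A.quotMk n i).codRestrict _ fun _ _ => rfl

/-- The completion map from `A` to its completion along its augmentation ideal. -/
noncomputable def completionMap : A.complex ⟶ A.completion where
  f i := ModuleCat.ofHom (A.completionMapGr i)
  comm' := by
    rintro i j (hij : i + 1 = j)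
    change ModuleCat.ofHom (A.completionMapGr i) ≫
      (if h : i + 1 = j then ModuleCat.ofHom (A.completionD i j h) else 0) =
      (if h : i + 1 = j then ModuleCat.ofHom (A.dRes i j h) else 0) ≫
        ModuleCat.ofHom (A.completionMapGr j)
    rw [dif_pos hij, dif_pos hij]
    ext x
    rfl

end AugDGA

/-! ### The cobar construction -/

namespace CoaugDGC

variable {k : Type u} [Field k] (C : CoaugDGC.{u, v} k)

/-- The coaugmentation coideal `C̄`, the kernel of the counit. -/
abbrev coideal : Submodule k C.carrier := LinearMap.ker (Coalgebra.counit (R := k) (A := C.carrier))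

/-- The Koszul sign operator `c ↦ (-1) ^ |c| c` of `C`. -/
noncomputable abbrev sign : C.carrier →ₗ[k] C.carrier := gradedSign C.gr_internal

theorem counit_sign (c : C.carrier) :
    Coalgebra.counit (R := k) (C.sign c) = Coalgebra.counit (R := k) c := by
  have : Coalgebra.counit (R := k) ∘ₗ C.sign = Coalgebra.counit (R := k) (A := C.carrier) := by
    refine graded_ext C.gr_internal fun i x hx => ?_
    rcases eq_or_ne i 0 with rfl | hi
    · simp [gradedSign_of_mem C.gr_internal hx]
    · simp [gradedSign_of_mem C.gr_internal hx, C.counit_gr i hi x hx]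
  exact LinearMap.congr_fun this c

/-- The differential of `C̄`. -/
noncomputable def dBar : C.coideal →ₗ[k] C.coideal :=
  C.d.restrict fun c _ => by simpa using C.counit_d c

/-- The Koszul sign operator of `C̄`. -/
noncomputable def signBar : C.coideal →ₗ[k] C.coideal :=
  C.sign.restrict fun c hc => by
    rw [LinearMap.mem_ker] at *
    rw [C.counit_sign, hc]

/-- The projection `c ↦ c - ε(c) 1` from `C` to `C̄`. -/
noncomputable def toBar : C.carrier →ₗ[k] C.coideal :=
  (LinearMap.id - (Coalgebra.counit (R := k)).smulRight C.unit).codRestrict _ fun c => by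
    simp [C.counit_unit]

theorem coe_toBar (c : C.carrier) :
    (C.toBar c : C.carrier) = c - Coalgebra.counit (R := k) c • C.unit := rfl

theorem toBar_coe (c : C.coideal) : C.toBar c = c := by
  apply Subtype.ext
  rw [coe_toBar, LinearMap.mem_ker.mp c.2]
  simp

theorem toBar_unit : C.toBar C.unit = 0 := by
  apply Subtype.ext
  simp [coe_toBar, C.counit_unit]

/-- The reduced comultiplication of `C̄`, see `coe_comulBar`. -/
noncomputable def comulBar : C.coideal →ₗ[k] C.coideal ⊗[k] C.coideal :=
  TensorProduct.map C.toBar C.toBar ∘ₗ Coalgebra.comul (R := k) ∘ₗ C.coideal.subtype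

/-- The reduced comultiplication is `c ↦ Δ c - c ⊗ 1 - 1 ⊗ c`. -/
theorem coe_comulBar (c : C.coideal) :
    TensorProduct.map C.coideal.subtype C.coideal.subtype (C.comulBar c) =
      Coalgebra.comul (R := k) (c : C.carrier) - (c : C.carrier) ⊗ₜ C.unit -
        C.unit ⊗ₜ (c : C.carrier) := by
  obtain ⟨c, hc⟩ := c
  have hc' : Coalgebra.counit (R := k) c = 0 := hc
  let e : C.carrier →ₗ[k] C.carrier := (Coalgebra.counit (R := k)).smulRight C.unit
  have h1 : C.coideal.subtype ∘ₗ C.toBar = LinearMap.id - e := by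
    ext x; simp [coe_toBar, e]
  have h2 : TensorProduct.map e LinearMap.id (Coalgebra.comul (R := k) c) = C.unit ⊗ₜ[k] c := by
    have := congrArg (TensorProduct.map (LinearMap.toSpanSingleton k _ C.unit)
      (LinearMap.id : C.carrier →ₗ[k] C.carrier)) (Coalgebra.rTensor_counit_comul (R := k) c)
    rw [LinearMap.rTensor, ← LinearMap.comp_apply, ← TensorProduct.map_comp] at this
    rw [show LinearMap.toSpanSingleton k _ C.unit ∘ₗ Coalgebra.counit = e from rfl] at this
    simpa using this
  have h3 : TensorProduct.map LinearMap.id e (Coalgebra.comul (R := k) c) = c ⊗ₜ[k] C.unit := by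
    have := congrArg (TensorProduct.map (LinearMap.id : C.carrier →ₗ[k] C.carrier)
      (LinearMap.toSpanSingleton k _ C.unit)) (Coalgebra.lTensor_counit_comul (R := k) c)
    rw [LinearMap.lTensor, ← LinearMap.comp_apply, ← TensorProduct.map_comp] at this
    rw [show LinearMap.toSpanSingleton k _ C.unit ∘ₗ Coalgebra.counit = e from rfl] at this
    simpa using this
  have h4 : TensorProduct.map e e (Coalgebra.comul (R := k) c) = 0 := by
    have : TensorProduct.map e e = TensorProduct.map LinearMap.id e ∘ₗ
        TensorProduct.map e (LinearMap.id : C.carrier →ₗ[k] C.carrier) := by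
      rw [← TensorProduct.map_comp]; rfl
    rw [this, LinearMap.comp_apply, h2]
    simp [e, hc']
  have h5 : TensorProduct.map (LinearMap.id - e) (LinearMap.id - e) =
      TensorProduct.map (LinearMap.id : C.carrier →ₗ[k] C.carrier) LinearMap.id -
        TensorProduct.map LinearMap.id e - TensorProduct.map e LinearMap.id +
        TensorProduct.map e e := by
    ext x y
    simp [TensorProduct.sub_tmul, TensorProduct.tmul_sub]
    abel
  simp only [comulBar, LinearMap.comp_apply, Submodule.subtype_apply]
  rw [← LinearMap.comp_apply, ← TensorProduct.map_comp, h1, h5]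
  simp [h2, h3, h4]

/-- The underlying algebra of the cobar construction, the tensor algebra on `C̄[-1]`. The element
`ι c` is the desuspension of `c`. -/
abbrev CobarAlg : Type (max u v) := TensorAlgebra k C.coideal

/-- The desuspension `C̄ → C̄[-1] → T(C̄[-1])`. -/
abbrev ι : C.coideal →ₗ[k] C.CobarAlg := TensorAlgebra.ι k

/-- `C.CobarMonomial n x` says that `x` is a product of desuspensions of homogeneous elements, of
total degree `n`. The desuspension of an element of degree `i` has degree `i + 1`. -/
inductive CobarMonomial : ℤ → C.CobarAlg → Prop
  | one : CobarMonomial 0 1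
  | cons {i n : ℤ} {c : C.coideal} {x : C.CobarAlg} (hc : (c : C.carrier) ∈ C.gr i)
      (hx : CobarMonomial n x) : CobarMonomial ((i + 1) + n) (C.ι c * x)

/-- The degree `n` part of `T(C̄[-1])`. -/
def cobarGr (n : ℤ) : Submodule k C.CobarAlg := Submodule.span k {x | C.CobarMonomial n x}

theorem ι_mem_cobarGr {i : ℤ} {c : C.coideal} (hc : (c : C.carrier) ∈ C.gr i) :
    C.ι c ∈ C.cobarGr (i + 1) := by
  have := CobarMonomial.cons hc CobarMonomial.one
  rw [mul_one, add_zero] at this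
  exact Submodule.subset_span this

theorem CobarMonomial.mul {m n : ℤ} {x y : C.CobarAlg} (hx : C.CobarMonomial m x)
    (hy : C.CobarMonomial n y) : C.CobarMonomial (m + n) (x * y) := by
  induction hx with
  | one => simpa using hy
  | cons hc _ ih =>
    rw [mul_assoc, add_assoc]
    exact CobarMonomial.cons hc ih

theorem cobarGr_mul (i j : ℤ) (a b : C.CobarAlg) (ha : a ∈ C.cobarGr i) (hb : b ∈ C.cobarGr j) :
    a * b ∈ C.cobarGr (i + j) := by
  induction ha using Submodule.span_induction with
  | zero => simp
  | add x y _ _ hx hy => rw [add_mul]; exact add_mem hx hy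
  | smul r x _ hx => rw [smul_mul_assoc]; exact Submodule.smul_mem _ r hx
  | mem x hx =>
    induction hb using Submodule.span_induction with
    | zero => simp
    | add x y _ _ hx hy => rw [mul_add]; exact add_mem hx hy
    | smul r x _ hx => rw [mul_smul_comm]; exact Submodule.smul_mem _ r hx
    | mem y hy => exact Submodule.subset_span (hx.mul C hy)

instance cobarGradedMonoid : SetLike.GradedMonoid C.cobarGr where
  one_mem := Submodule.subset_span CobarMonomial.one
  mul_mem _ _ _ _ ha hb := C.cobarGr_mul _ _ _ _ ha hb

theorem toBar_mem {i : ℤ} {c : C.carrier} (hc : c ∈ C.gr i) : (C.toBar c : C.carrier) ∈ C.gr i := by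
  rw [coe_toBar]
  rcases eq_or_ne i 0 with rfl | hi
  · exact sub_mem hc ((C.gr 0).smul_mem _ C.unit_mem)
  · simpa [C.counit_gr i hi c hc] using hc

/-- The desuspension, as a map on `C` that vanishes on the image of the coaugmentation. -/
noncomputable def s : C.carrier →ₗ[k] C.CobarAlg := C.ι ∘ₗ C.toBar

theorem s_mem {i : ℤ} {c : C.carrier} (hc : c ∈ C.gr i) : C.s c ∈ C.cobarGr (i + 1) :=
  C.ι_mem_cobarGr (C.toBar_mem hc)

theorem s_coe (c : C.coideal) : C.s c = C.ι c := by simp [s, toBar_coe]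

theorem cobarGr_internal : DirectSum.IsInternal C.cobarGr := by
  let g : C.carrier →ₗ[k] ⨁ n, C.cobarGr n := gradedLift C.gr_internal fun i =>
    DirectSum.lof k ℤ (fun n => C.cobarGr n) (i + 1) ∘ₗ
      (C.s.restrict fun c hc => C.s_mem hc)
  have hg : ∀ {i : ℤ} {c : C.carrier} (hc : c ∈ C.gr i),
      g c = DirectSum.of (fun n => C.cobarGr n) (i + 1) ⟨C.s c, C.s_mem hc⟩ := by
    intro i c hc
    simp only [g]
    rw [gradedLift_of_mem C.gr_internal _ hc]
    rfl
  let f : C.CobarAlg →ₐ[k] ⨁ n, C.cobarGr n := TensorAlgebra.lift k (g ∘ₗ C.coideal.subtype)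
  have hf : ∀ c : C.coideal, f (C.ι c) = g c := fun c => by simp [f]
  have hcg : ∀ c : C.carrier, DirectSum.coeAlgHom C.cobarGr (g c) = C.s c := by
    intro c
    induction c using graded_induction C.gr_internal with
    | h0 => simp
    | hadd x y hx hy => rw [map_add, map_add, map_add, hx, hy]
    | hmem i x hx => rw [hg hx, DirectSum.coeAlgHom_of]
  have hm : ∀ n x (hx : C.CobarMonomial n x),
      f x = DirectSum.of (fun n => C.cobarGr n) n ⟨x, Submodule.subset_span hx⟩ := by
    intro n x hx
    induction hx with
    | one => rw [map_one]; rfl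
    | cons hc hx ih =>
      rw [map_mul, hf, ih, hg hc, DirectSum.of_mul_of]
      congr 1
      exact Subtype.ext (congrArg (· * _) (C.s_coe _))
  let _ : GradedAlgebra C.cobarGr := GradedAlgebra.ofAlgHom C.cobarGr f
    (by
      ext c
      simp only [LinearMap.comp_apply, AlgHom.toLinearMap_apply, AlgHom.comp_apply, AlgHom.id_apply]
      rw [hf, hcg, s_coe])
    (by
      rintro n ⟨x, hx⟩
      induction hx using Submodule.span_induction with
      | mem x hx => exact hm n x hx
      | zero =>
        rw [map_zero]
        exact (map_zero (DirectSum.of (fun n => C.cobarGr n) n)).symm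
      | add x y hx' hy' hx hy =>
        rw [map_add, hx, hy, ← map_add]
        rfl
      | smul r x hx' hx =>
        rw [map_smul, hx]
        exact (map_smul (DirectSum.lof k ℤ (fun n => C.cobarGr n) n) r ⟨x, hx'⟩).symm)
  exact DirectSum.Decomposition.isInternal C.cobarGr

/-- The cobar differential on generators:
`ι c ↦ - ι (d c) - ∑ (-1) ^ |c'| ι c' * ι c''`, where `∑ c' ⊗ c''` is the reduced
comultiplication of `c`. -/
noncomputable def cobarD₀ : C.coideal →ₗ[k] C.CobarAlg :=
  -(C.ι ∘ₗ C.dBar) -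
    LinearMap.mul' k C.CobarAlg ∘ₗ TensorProduct.map (C.ι ∘ₗ C.signBar) C.ι ∘ₗ C.comulBar

/-- The map `c ↦ !![-ι ((-1) ^ |c| c), cobarD₀ c; 0, ι c]`. Note that `-(-1) ^ |c|` is the sign
`(-1) ^ |ι c|`. -/
noncomputable def cobarMatrix : C.coideal →ₗ[k] Matrix (Fin 2) (Fin 2) C.CobarAlg where
  toFun c := !![-C.ι (C.signBar c), C.cobarD₀ c; 0, C.ι c]
  map_add' x y := by
    ext i j
    fin_cases i <;> fin_cases j <;> simp
    abel
  map_smul' r x := by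
    ext i j
    fin_cases i <;> fin_cases j <;> simp

/-- The differential of the cobar construction: the graded derivation of `T(C̄[-1])` that extends
`cobarD₀` (see `cobarD_ι` and `cobarD_leibniz`). It is the upper right entry of the algebra
homomorphism to upper triangular matrices that extends `cobarMatrix`. -/
noncomputable def cobarD : C.CobarAlg →ₗ[k] C.CobarAlg :=
  Matrix.entryLinearMap k C.CobarAlg (0 : Fin 2) (1 : Fin 2) ∘ₗ
    (TensorAlgebra.lift k C.cobarMatrix).toLinearMap

theorem cobarD_ι (c : C.coideal) : C.cobarD (C.ι c) = C.cobarD₀ c := by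
  simp [cobarD, cobarMatrix]

theorem lift_cobarMatrix_11 (x : C.CobarAlg) :
    TensorAlgebra.lift k C.cobarMatrix x 1 0 = 0 ∧
      TensorAlgebra.lift k C.cobarMatrix x 1 1 = x := by
  induction x using TensorAlgebra.induction with
  | algebraMap r => simp [Matrix.algebraMap_matrix_apply]
  | ι c => simp [cobarMatrix]
  | mul a b ha hb => simp [Matrix.mul_apply, Fin.sum_univ_two, ha, hb]
  | add a b ha hb => simp [ha, hb]

theorem lift_cobarMatrix_00 {n : ℤ} {x : C.CobarAlg} (hx : x ∈ C.cobarGr n) :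
    TensorAlgebra.lift k C.cobarMatrix x 0 0 = (-1 : k) ^ n • x := by
  induction hx using Submodule.span_induction with
  | zero => simp
  | add x y _ _ hx hy => simp [hx, hy]
  | smul r x _ hx => simp [hx, smul_comm r]
  | mem x hx =>
    induction hx with
    | one => simp
    | @cons i n c x hc hx ih =>
      have h : C.signBar c = (-1 : k) ^ i • c :=
        Subtype.ext (gradedSign_of_mem C.gr_internal hc)
      rw [map_mul, Matrix.mul_apply, Fin.sum_univ_two, ih, (C.lift_cobarMatrix_11 x).1]
      rw [zpow_add₀ (by simp), neg_one_zpow_succ]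
      simp [cobarMatrix, h, smul_smul, mul_comm]

theorem cobarD_leibniz (n : ℤ) (a b : C.CobarAlg) (ha : a ∈ C.cobarGr n) :
    C.cobarD (a * b) = C.cobarD a * b + (-1 : k) ^ n • (a * C.cobarD b) := by
  simp only [cobarD, LinearMap.comp_apply, AlgHom.toLinearMap_apply, map_mul,
    Matrix.entryLinearMap_apply, Matrix.mul_apply, Fin.sum_univ_two, C.lift_cobarMatrix_00 ha,
    (C.lift_cobarMatrix_11 b).2, smul_mul_assoc]
  rw [add_comm]

theorem sign_unit : C.sign C.unit = C.unit := by
  simp [gradedSign_of_mem C.gr_internal C.unit_mem]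

theorem toBar_sign (c : C.carrier) : C.toBar (C.sign c) = C.signBar (C.toBar c) := by
  apply Subtype.ext
  change _ = C.sign (C.toBar c)
  rw [coe_toBar, coe_toBar, counit_sign, map_sub, map_smul, sign_unit]

theorem toBar_d (c : C.carrier) : C.toBar (C.d c) = C.dBar (C.toBar c) := by
  apply Subtype.ext
  change _ = C.d (C.toBar c)
  rw [coe_toBar, coe_toBar, C.counit_d, map_sub, map_smul, C.d_unit]
  simp

/-- The map `x ⊗ y ↦ s (-1) ^ |x| x * s y`. -/
noncomputable def ss : C.carrier ⊗[k] C.carrier →ₗ[k] C.CobarAlg :=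
  LinearMap.mul' k C.CobarAlg ∘ₗ TensorProduct.map (C.s ∘ₗ C.sign) C.s

theorem ss_tmul (x y : C.carrier) : C.ss (x ⊗ₜ y) = C.s (C.sign x) * C.s y := rfl

theorem cobarD_s (c : C.carrier) :
    C.cobarD (C.s c) = -C.s (C.d c) - C.ss (Coalgebra.comul (R := k) c) := by
  have h0 : C.s C.unit = 0 := by simp [s, toBar_unit]
  have h1 : ∀ c : C.coideal, C.cobarD (C.s c) =
      -C.s (C.d c) - C.ss (Coalgebra.comul (R := k) (c : C.carrier)) := by
    intro c
    rw [s_coe, cobarD_ι]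
    simp only [cobarD₀, ss, comulBar, LinearMap.sub_apply, LinearMap.neg_apply,
      LinearMap.comp_apply, Submodule.subtype_apply]
    congr 2
    · simp [s, toBar_d, toBar_coe]
    · rw [← LinearMap.comp_apply (TensorProduct.map _ _), ← TensorProduct.map_comp]
      have : (C.ι ∘ₗ C.signBar) ∘ₗ C.toBar = C.s ∘ₗ C.sign := by
        refine LinearMap.ext fun x => ?_
        simp [s, toBar_sign]
      rw [this]
      rfl
  have hc : c = (C.toBar c : C.carrier) + Coalgebra.counit (R := k) c • C.unit := by
    simp [coe_toBar]
  rw [hc]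
  simp only [map_add, map_smul, h1, C.d_unit, C.comul_unit, ss_tmul, h0]
  simp

theorem cobarD₀_mem {i : ℤ} {c : C.coideal} (hc : (c : C.carrier) ∈ C.gr i) :
    C.cobarD (C.ι c) ∈ C.cobarGr (i + 1 + 1) := by
  rw [← s_coe, cobarD_s]
  refine sub_mem (neg_mem (C.s_mem (C.d_mem i _ hc))) ?_
  have h := C.comul_gr i _ hc
  have : (⨆ p : ℤ, LinearMap.range (TensorProduct.mapIncl (C.gr p) (C.gr (i - p)))) ≤
      (C.cobarGr (i + 1 + 1)).comap C.ss := by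
    refine iSup_le fun p => ?_
    rintro _ ⟨t, rfl⟩
    induction t with
    | zero => simp
    | add x y hx hy => rw [map_add]; exact add_mem hx hy
    | tmul x y =>
      rw [Submodule.mem_comap, TensorProduct.mapIncl, TensorProduct.map_tmul, ss_tmul]
      have := C.cobarGr_mul _ _ _ _ (C.s_mem (i := p) (c := C.sign x)
        (by rw [sign, gradedSign_of_mem C.gr_internal x.2]; exact Submodule.smul_mem _ _ x.2))
        (C.s_mem y.2)
      have e : p + 1 + (i - p + 1) = i + 1 + 1 := by ring
      rwa [e] at this
  exact this h

theorem cobarD_one : C.cobarD 1 = 0 := by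
  have := C.cobarD_leibniz 0 1 1 (Submodule.subset_span CobarMonomial.one)
  simpa using this

theorem cobarD_mem (n : ℤ) (a : C.CobarAlg) (ha : a ∈ C.cobarGr n) :
    C.cobarD a ∈ C.cobarGr (n + 1) := by
  induction ha using Submodule.span_induction with
  | zero => simp
  | add x y _ _ hx hy => rw [map_add]; exact add_mem hx hy
  | smul r x _ hx => rw [map_smul]; exact Submodule.smul_mem _ r hx
  | mem x hx =>
    induction hx with
    | one => simp [cobarD_one]
    | @cons i n c x hc hx ih =>
      rw [C.cobarD_leibniz (i + 1) _ _ (C.ι_mem_cobarGr hc)]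
      refine add_mem ?_ (Submodule.smul_mem _ _ ?_)
      · have := C.cobarGr_mul _ _ _ _ (C.cobarD₀_mem hc) (Submodule.subset_span hx)
        have e : i + 1 + 1 + n = i + 1 + n + 1 := by ring
        rwa [e] at this
      · have := C.cobarGr_mul _ _ _ _ (C.ι_mem_cobarGr hc) ih
        rwa [← add_assoc] at this

theorem d_sign (c : C.carrier) : C.d (C.sign c) = -C.sign (C.d c) := by
  have : C.d ∘ₗ C.sign = -(C.sign ∘ₗ C.d) := by
    refine graded_ext C.gr_internal fun i x hx => ?_
    simp [gradedSign_of_mem C.gr_internal hx, gradedSign_of_mem C.gr_internal (C.d_mem i x hx),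
      neg_one_zpow_succ]
  exact LinearMap.congr_fun this c

theorem comul_sign (c : C.carrier) : Coalgebra.comul (R := k) (C.sign c) =
    TensorProduct.map C.sign C.sign (Coalgebra.comul (R := k) c) := by
  have : Coalgebra.comul (R := k) ∘ₗ C.sign =
      TensorProduct.map C.sign C.sign ∘ₗ Coalgebra.comul (R := k) (A := C.carrier) := by
    refine graded_ext C.gr_internal fun i c hc => ?_
    rw [LinearMap.comp_apply, LinearMap.comp_apply, sign, gradedSign_of_mem C.gr_internal hc,
      map_smul]
    have h : (⨆ p : ℤ, LinearMap.range (TensorProduct.mapIncl (C.gr p) (C.gr (i - p)))) ≤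
        LinearMap.ker (TensorProduct.map C.sign C.sign - (-1 : k) ^ i • LinearMap.id) := by
      refine iSup_le fun p => ?_
      rintro _ ⟨t, rfl⟩
      induction t with
      | zero => simp
      | add x y hx hy => rw [map_add]; exact add_mem hx hy
      | tmul x y =>
        have e : (-1 : k) ^ i = (-1) ^ p * (-1) ^ (i - p) := by
          rw [← zpow_add₀ (by simp)]; congr 1; ring
        simp [TensorProduct.mapIncl, gradedSign_of_mem C.gr_internal x.2,
          gradedSign_of_mem C.gr_internal y.2, TensorProduct.smul_tmul', TensorProduct.tmul_smul,
          smul_smul, e, mul_comm]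
    have := h (C.comul_gr i c hc)
    rw [LinearMap.mem_ker, LinearMap.sub_apply, sub_eq_zero] at this
    simpa using this.symm
  exact LinearMap.congr_fun this c

theorem cobarD_s_mul (x : C.carrier) (b : C.CobarAlg) :
    C.cobarD (C.s x * b) = C.cobarD (C.s x) * b - C.s (C.sign x) * C.cobarD b := by
  induction x using graded_induction C.gr_internal with
  | h0 => simp
  | hadd x y hx hy => simp only [map_add, add_mul, hx, hy]; abel
  | hmem i x hx =>
    rw [C.cobarD_leibniz _ _ _ (C.s_mem hx), sign, gradedSign_of_mem C.gr_internal hx,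
      neg_one_zpow_succ]
    simp [sub_eq_add_neg]

/-- The map `x ⊗ y ⊗ z ↦ s x * s (-1) ^ |y| y * s z`. -/
noncomputable def sss : C.carrier ⊗[k] (C.carrier ⊗[k] C.carrier) →ₗ[k] C.CobarAlg :=
  LinearMap.mul' k C.CobarAlg ∘ₗ TensorProduct.map C.s C.ss

theorem ss_sign (t : C.carrier ⊗[k] C.carrier) (z : C.carrier) :
    C.ss (TensorProduct.map C.sign C.sign t) * C.s z =
      C.sss (TensorProduct.assoc k _ _ _ (t ⊗ₜ z)) := by
  induction t with
  | zero => simp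
  | add x y hx hy => simp only [map_add, add_mul, TensorProduct.add_tmul, hx, hy]
  | tmul x y => simp [ss_tmul, sss, gradedSign_gradedSign, mul_assoc]

theorem cobarD_ss (t : C.carrier ⊗[k] C.carrier) :
    C.cobarD (C.ss t) = C.ss (TensorProduct.map C.d LinearMap.id t) +
      C.ss (TensorProduct.map C.sign C.d t) -
      C.sss (TensorProduct.assoc k _ _ _ ((Coalgebra.comul (R := k)).rTensor C.carrier t)) +
      C.sss ((Coalgebra.comul (R := k)).lTensor C.carrier t) := by
  induction t with
  | zero => simp
  | add x y hx hy => simp only [map_add, hx, hy]; abel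
  | tmul x y =>
    rw [LinearMap.rTensor_tmul, LinearMap.lTensor_tmul, TensorProduct.map_tmul,
      TensorProduct.map_tmul, ss_tmul, ss_tmul, ss_tmul, ← ss_sign, cobarD_s_mul, cobarD_s,
      cobarD_s, gradedSign_gradedSign, d_sign, comul_sign]
    have : C.sss (x ⊗ₜ[k] Coalgebra.comul (R := k) y) = C.s x * C.ss (Coalgebra.comul (R := k) y) :=
      rfl
    rw [this]
    simp only [map_neg, neg_neg, LinearMap.id_apply, mul_sub, sub_mul, mul_neg]
    abel

theorem cobarD_cobarD_s (c : C.carrier) : C.cobarD (C.cobarD (C.s c)) = 0 := by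
  rw [cobarD_s, map_sub, map_neg, cobarD_s, cobarD_ss, C.d_d, C.comul_d,
    Coalgebra.coassoc_apply]
  simp only [map_add, map_zero]
  abel

theorem cobarD_cobarD (a : C.CobarAlg) : C.cobarD (C.cobarD a) = 0 := by
  induction a using graded_induction C.cobarGr_internal with
  | h0 => simp
  | hadd x y hx hy => simp only [map_add, hx, hy, add_zero]
  | hmem n x hx =>
    induction hx using Submodule.span_induction with
    | zero => simp
    | add x y _ _ hx hy => simp only [map_add, hx, hy, add_zero]
    | smul r x _ hx => simp only [map_smul, hx, smul_zero]
    | mem x hx =>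
      induction hx with
      | one => simp [cobarD_one]
      | @cons i n c x hc hx ih =>
        have h := C.cobarD_cobarD_s c
        rw [s_coe] at h
        rw [C.cobarD_leibniz (i + 1) _ _ (C.ι_mem_cobarGr hc), map_add, map_smul,
          C.cobarD_leibniz (i + 1 + 1) _ _ (C.cobarD₀_mem hc),
          C.cobarD_leibniz (i + 1) _ _ (C.ι_mem_cobarGr hc), h, ih, neg_one_zpow_succ (i + 1)]
        simp

theorem aug_cobarD (a : C.CobarAlg) :
    TensorAlgebra.algebraMapInv (C.cobarD a) = (0 : k) := by
  induction a using graded_induction C.cobarGr_internal with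
  | h0 => simp
  | hadd x y hx hy => simp only [map_add, hx, hy, add_zero]
  | hmem n x hx =>
    induction hx using Submodule.span_induction with
    | zero => simp
    | add x y _ _ hx hy => simp only [map_add, hx, hy, add_zero]
    | smul r x _ hx => simp only [map_smul, hx, smul_zero]
    | mem x hx =>
      induction hx with
      | one => simp [cobarD_one]
      | @cons i n c x hc hx ih =>
        have h : ∀ t : C.coideal ⊗[k] C.coideal, TensorAlgebra.algebraMapInv (LinearMap.mul' k
            C.CobarAlg (TensorProduct.map (C.ι ∘ₗ C.signBar) C.ι t)) = (0 : k) := by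
          intro t
          induction t with
          | zero => simp
          | add x y hx hy => simp only [map_add, hx, hy, add_zero]
          | tmul x y => simp [TensorAlgebra.algebraMapInv]
        have h' : TensorAlgebra.algebraMapInv (C.cobarD₀ c) = (0 : k) := by
          simp only [cobarD₀, LinearMap.sub_apply, LinearMap.neg_apply, LinearMap.comp_apply,
            map_sub, map_neg, h]
          simp [TensorAlgebra.algebraMapInv]
        rw [C.cobarD_leibniz (i + 1) _ _ (C.ι_mem_cobarGr hc), map_add, map_smul, map_mul, map_mul,
          cobarD_ι, h', ih]
        simp

theorem aug_cobarGr (n : ℤ) (hn : n ≠ 0) (a : C.CobarAlg) (ha : a ∈ C.cobarGr n) :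
    TensorAlgebra.algebraMapInv a = (0 : k) := by
  induction ha using Submodule.span_induction with
  | zero => simp
  | add x y _ _ hx hy => simp only [map_add, hx, hy, add_zero]
  | smul r x _ hx => simp only [map_smul, hx, smul_zero]
  | mem x hx =>
    cases hx with
    | one => exact absurd rfl hn
    | cons hc hx => simp [TensorAlgebra.algebraMapInv]

/-- The cobar construction `Ω(C)`: the tensor algebra `T(C̄[-1])` with the differential `cobarD` and
the augmentation that vanishes on `C̄[-1]`. -/
noncomputable def cobar : AugDGA.{u, max u v} k where
  carrier := C.CobarAlg
  gr := C.cobarGr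
  gr_internal := C.cobarGr_internal
  one_mem := Submodule.subset_span CobarMonomial.one
  mul_mem := C.cobarGr_mul
  d := C.cobarD
  d_mem := C.cobarD_mem
  d_d := C.cobarD_cobarD
  leibniz := C.cobarD_leibniz
  aug := TensorAlgebra.algebraMapInv
  aug_gr := C.aug_cobarGr
  aug_d := C.aug_cobarD

/-- The underlying complex of the completed cobar construction `Ω̂(C)`, whose underlying graded
space is the completed tensor algebra on `C̄[-1]`: the completion of `Ω(C)` along its augmentation
ideal. -/
noncomputable abbrev completedCobar : CochainComplex (ModuleCat.{max u v} k) ℤ :=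
  C.cobar.completion

/-- The completion map `Ω(C) → Ω̂(C)`. -/
noncomputable abbrev cobarCompletionMap : C.cobar.complex ⟶ C.completedCobar :=
  C.cobar.completionMap

end CoaugDGC

/-! ### The dual coalgebra of a raylike dg algebra -/

theorem tensor_eq_zero_of_lTensor {k : Type u} [Field k] {U : Type v} {V : Type w} [AddCommGroup U]
    [AddCommGroup V] [Module k U] [Module k V] {S : Type*} (φ : S → V →ₗ[k] k)
    (hφ : ∀ v, (∀ s, φ s v = 0) → v = 0) (x : U ⊗[k] V)
    (hx : ∀ s, TensorProduct.rid k U ((φ s).lTensor U x) = 0) : x = 0 := by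
  classical
  let b := Module.Basis.ofVectorSpace k U
  have key : ∀ (s : S) (i) (y : U ⊗[k] V), b.repr (TensorProduct.rid k U ((φ s).lTensor U y)) i =
      φ s (TensorProduct.equivFinsuppOfBasisLeft b y i) := by
    intro s i y
    induction y with
    | zero => simp
    | add y z hy hz => simp [hy, hz]
    | tmul u v => simp [TensorProduct.equivFinsuppOfBasisLeft_apply_tmul, mul_comm]
  apply (TensorProduct.equivFinsuppOfBasisLeft b).injective
  ext i
  rw [map_zero, Finsupp.zero_apply]
  refine hφ _ fun s => ?_
  rw [← key, hx]
  simp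

theorem coassoc_of_eval {k : Type u} [Field k] {W : Type v} [AddCommGroup W] [Module k W]
    {R : Type w} [Semigroup R] (ev : R → W →ₗ[k] k) (hev : ∀ f, (∀ a, ev a f = 0) → f = 0)
    (Δ : W →ₗ[k] W ⊗[k] W)
    (hΔ : ∀ f a b, TensorProduct.lid k k (TensorProduct.map (ev a) (ev b) (Δ f)) = ev (a * b) f) :
    (TensorProduct.assoc k W W W).toLinearMap ∘ₗ Δ.rTensor W ∘ₗ Δ = Δ.lTensor W ∘ₗ Δ := by
  have hp : ∀ (t : W ⊗[k] W) (a b : R), TensorProduct.lid k k (TensorProduct.map (ev a) (ev b) t) =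
      ev a (TensorProduct.rid k W ((ev b).lTensor W t)) := by
    intro t a b
    induction t with
    | zero => simp
    | add x y hx hy => simp only [map_add, hx, hy]
    | tmul x y => simp [mul_comm]
  let ev₂ : R × R → W ⊗[k] W →ₗ[k] k := fun s =>
    (TensorProduct.lid k k).toLinearMap ∘ₗ TensorProduct.map (ev s.1) (ev s.2)
  have hev₂ : ∀ t, (∀ s, ev₂ s t = 0) → t = 0 := by
    intro t ht
    refine tensor_eq_zero_of_lTensor ev hev _ fun b => hev _ fun a => ?_
    rw [← hp]
    exact ht (a, b)
  refine LinearMap.ext fun f => sub_eq_zero.mp ?_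
  refine tensor_eq_zero_of_lTensor ev₂ hev₂ _ ?_
  rintro ⟨b, c⟩
  refine hev _ fun a => ?_
  have h1 : ∀ t : W ⊗[k] W,
      ev a (TensorProduct.rid k W ((ev₂ (b, c)).lTensor W (Δ.lTensor W t))) =
        TensorProduct.lid k k (TensorProduct.map (ev a) (ev (b * c)) t) := by
    intro t
    induction t with
    | zero => simp
    | add x y hx hy => simp only [map_add, hx, hy]
    | tmul x y => simp [ev₂, hΔ, mul_comm]
  have h3 : ∀ (t : W ⊗[k] W) (z : W),
      ev a (TensorProduct.rid k W ((ev₂ (b, c)).lTensor W (TensorProduct.assoc k W W W (t ⊗ₜ z)))) =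
        TensorProduct.lid k k (TensorProduct.map (ev a) (ev b) t) * ev c z := by
    intro t z
    induction t with
    | zero => simp
    | add x y hx hy => simp only [map_add, TensorProduct.add_tmul, hx, hy, add_mul]
    | tmul x y =>
      simp [ev₂]
      ring
  have h2 : ∀ t : W ⊗[k] W,
      ev a (TensorProduct.rid k W ((ev₂ (b, c)).lTensor W
        (TensorProduct.assoc k W W W (Δ.rTensor W t)))) =
        TensorProduct.lid k k (TensorProduct.map (ev (a * b)) (ev c) t) := by
    intro t
    induction t with
    | zero => simp
    | add x y hx hy => simp only [map_add, hx, hy]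
    | tmul x y => rw [LinearMap.rTensor_tmul, h3, hΔ]; simp
  simp only [map_sub, LinearMap.comp_apply, LinearEquiv.coe_coe]
  rw [sub_eq_zero, h1, h2, hΔ, hΔ, mul_assoc]

namespace AugDGA

variable {k : Type u} [Field k] (E : AugDGA.{u, v} k)

/-- The degree `n` part of the linear dual, that is the dual of `E⁻ⁿ`: the functionals that vanish
on all other graded pieces. -/
def dualGr (n : ℤ) : Submodule k (E.carrier →ₗ[k] k) where
  carrier := {f | ∀ i, i ≠ -n → ∀ a ∈ E.gr i, f a = 0}
  add_mem' := by
    intro f g hf hg i hi a ha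
    simp [hf i hi a ha, hg i hi a ha]
  zero_mem' := by simp
  smul_mem' := by
    intro r f hf i hi a ha
    simp [hf i hi a ha]

/-- The graded linear dual `E^*` as a space of functionals on `E`: the sum of the duals of all the
graded pieces of `E`. -/
def gradedDualSubmodule : Submodule k (E.carrier →ₗ[k] k) := ⨆ n, E.dualGr n

theorem dualGr_le (n : ℤ) : E.dualGr n ≤ E.gradedDualSubmodule := le_iSup E.dualGr n

/-- The underlying space of the graded linear dual `E^*`. -/
def GradedDual : Type (max u v) := E.gradedDualSubmodule

instance gradedDualAddCommGroup : AddCommGroup E.GradedDual :=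
  @Module.addCommMonoidToAddCommGroup k E.gradedDualSubmodule _
    (Submodule.addCommMonoid E.gradedDualSubmodule) (Submodule.module E.gradedDualSubmodule)

instance gradedDualModule : Module k E.GradedDual := Submodule.module E.gradedDualSubmodule

/-- The inclusion of `E^*` into the space of all functionals on `E`. -/
def dualIncl : E.GradedDual →ₗ[k] (E.carrier →ₗ[k] k) := E.gradedDualSubmodule.subtype

/-- The degree `n` part of `E^*`. -/
def gradedDualGr (n : ℤ) : Submodule k E.GradedDual := (E.dualGr n).comap E.dualIncl

theorem gradedDual_induction {P : E.GradedDual → Prop}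
    (h0 : P 0) (hadd : ∀ x y, P x → P y → P (x + y)) (hmem : ∀ n, ∀ x ∈ E.gradedDualGr n, P x)
    (x : E.GradedDual) : P x := by
  obtain ⟨x, hx⟩ := x
  refine Submodule.iSup_induction' E.dualGr (motive := fun x hx => P ⟨x, hx⟩) ?_ h0 ?_ hx
  · intro n f hf
    exact hmem n _ hf
  · intro f g hf hg
    exact hadd _ _

theorem gradedDualGr_internal : DirectSum.IsInternal E.gradedDualGr := by
  apply DirectSum.isInternal_submodule_of_iSupIndep_of_iSup_eq_top
  · intro n
    rw [Submodule.disjoint_def]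
    intro f hf hf'
    have : (⨆ j, ⨆ (_ : j ≠ n), E.gradedDualGr j) ≤
        LinearMap.ker (LinearMap.lcomp k k (E.gr (-n)).subtype ∘ₗ E.dualIncl) := by
      refine iSup_le fun j => iSup_le fun hj => ?_
      intro g hg
      rw [LinearMap.mem_ker]
      ext ⟨a, ha⟩
      exact hg (-n) (by simpa using hj.symm) a ha
    have h := this hf'
    rw [LinearMap.mem_ker] at h
    apply Subtype.ext
    refine graded_ext E.gr_internal fun i a ha => ?_
    by_cases hi : i = -n
    · subst hi
      exact LinearMap.congr_fun h ⟨a, ha⟩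
    · exact hf i hi a ha
  · rw [eq_top_iff]
    intro f _
    induction f using E.gradedDual_induction with
    | h0 => exact zero_mem _
    | hadd x y hx hy => exact add_mem (hx trivial) (hy trivial)
    | hmem n x hx => exact Submodule.mem_iSup_of_mem n hx

/-- Evaluation of an element of `E^*` at `a`. -/
def dualEval (a : E.carrier) : E.GradedDual →ₗ[k] k :=
  LinearMap.applyₗ a ∘ₗ E.dualIncl

theorem dualEval_apply (a : E.carrier) (f : E.GradedDual) : E.dualEval a f = E.dualIncl f a := rfl

/-- The natural map `E^* ⊗ E^* → (E ⊗ E)^*`, `f ⊗ g ↦ (a ⊗ b ↦ f a * g b)`. -/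
noncomputable def dualPairing :
    E.GradedDual ⊗[k] E.GradedDual →ₗ[k] (E.carrier ⊗[k] E.carrier →ₗ[k] k) :=
  TensorProduct.dualDistrib k E.carrier E.carrier ∘ₗ
    TensorProduct.map E.dualIncl E.dualIncl

theorem dualPairing_tmul (f g : E.GradedDual) (a b : E.carrier) :
    E.dualPairing (f ⊗ₜ g) (a ⊗ₜ b) = E.dualIncl f a * E.dualIncl g b := by
  simp [dualPairing]

theorem dualPairing_eq (t : E.GradedDual ⊗[k] E.GradedDual) (a b : E.carrier) :
    E.dualPairing t (a ⊗ₜ b) =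
      TensorProduct.lid k k (TensorProduct.map (E.dualEval a) (E.dualEval b) t) := by
  induction t with
  | zero => simp
  | add x y hx hy => simp only [map_add, LinearMap.add_apply, hx, hy]
  | tmul f g => simp [dualPairing_tmul, dualEval_apply]

theorem dualEval_lTensor (t : E.GradedDual ⊗[k] E.GradedDual) (a b : E.carrier) :
    E.dualEval a (TensorProduct.rid k _ ((E.dualEval b).lTensor _ t)) =
      E.dualPairing t (a ⊗ₜ b) := by
  induction t with
  | zero => simp
  | add x y hx hy => simp [hx, hy]
  | tmul f g => simp [dualPairing_tmul, dualEval_apply, mul_comm]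

theorem dualEval_rTensor (t : E.GradedDual ⊗[k] E.GradedDual) (a b : E.carrier) :
    E.dualEval b (TensorProduct.lid k _ ((E.dualEval a).rTensor _ t)) =
      E.dualPairing t (a ⊗ₜ b) := by
  induction t with
  | zero => simp
  | add x y hx hy => simp [hx, hy]
  | tmul f g => simp [dualPairing_tmul, dualEval_apply]

theorem dualEval_ext (f : E.GradedDual) (h : ∀ a, E.dualEval a f = 0) : f = 0 :=
  Subtype.ext (LinearMap.ext h)

theorem dualPairing_ext {t t' : E.GradedDual ⊗[k] E.GradedDual}
    (h : ∀ a b, E.dualPairing t (a ⊗ₜ b) = E.dualPairing t' (a ⊗ₜ b)) : t = t' := by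
  rw [← sub_eq_zero]
  refine tensor_eq_zero_of_lTensor E.dualEval E.dualEval_ext _ fun b => E.dualEval_ext _ fun a => ?_
  rw [dualEval_lTensor, map_sub, LinearMap.sub_apply, h, sub_self]

theorem dualPairing_injective : Function.Injective E.dualPairing := fun t t' h =>
  E.dualPairing_ext fun a b => by rw [h]

theorem d_comp_mem (n : ℤ) (f : E.carrier →ₗ[k] k) (hf : f ∈ E.dualGr n) :
    f ∘ₗ E.d ∈ E.dualGr (n + 1) := fun i hi a ha =>
  hf (i + 1) (fun e => hi (by rw [neg_add, ← e]; ring)) _ (E.d_mem i a ha)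

/-- The differential of `E^*`, the transpose of that of `E`. -/
def dualD : E.GradedDual →ₗ[k] E.GradedDual :=
  (LinearMap.lcomp k k E.d).restrict fun f hf => by
    refine Submodule.iSup_induction E.dualGr (motive := fun f => f ∘ₗ E.d ∈ E.gradedDualSubmodule) hf ?_ ?_ ?_
    · intro n f hf
      exact E.dualGr_le _ (E.d_comp_mem n f hf)
    · simp
    · intro f g hf hg
      rw [LinearMap.add_comp]
      exact add_mem hf hg

theorem aug_mem_dualGr : E.aug.toLinearMap ∈ E.dualGr 0 := fun i hi a ha =>
  E.aug_gr i (by simpa using hi) a ha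

/-- The augmentation of `E`, as an element of `E^*`. -/
def dualUnit : E.GradedDual := ⟨E.aug.toLinearMap, E.dualGr_le 0 E.aug_mem_dualGr⟩

/-- The extension by zero of a functional on `Eⁱ`. -/
noncomputable def dualExt (i : ℤ) : Module.Dual k (E.gr i) →ₗ[k] E.GradedDual :=
  (LinearMap.lcomp k k (gradedProj E.gr_internal i)).codRestrict _ fun f =>
    E.dualGr_le (-i) fun j hj a ha => by
      simp [gradedProj_ne E.gr_internal (by simpa using hj) ha]

theorem dualExt_apply (i : ℤ) (f : Module.Dual k (E.gr i)) (a : E.carrier) :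
    E.dualIncl (E.dualExt i f) a = f (gradedProj E.gr_internal i a) := rfl

theorem dualExt_mem (i : ℤ) (f : Module.Dual k (E.gr i)) :
    E.dualExt i f ∈ E.gradedDualGr (-i) := fun j hj a ha => by
  rw [dualExt_apply,
    gradedProj_ne E.gr_internal (by simpa using hj) ha, map_zero]

variable {E} in
theorem IsRaylike.finite (h : E.IsRaylike) (n : ℤ) :
    {p : ℤ | E.gr p ≠ ⊥ ∧ E.gr (n - p) ≠ ⊥}.Finite := by
  rcases h.2 with ⟨b, hb⟩ | ⟨b, hb⟩
  · refine (Set.finite_Icc (n - b) b).subset ?_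
    rintro p ⟨hp, hp'⟩
    refine ⟨?_, ?_⟩
    · by_contra hlt
      exact hp' (hb _ (by omega))
    · by_contra hlt
      exact hp (hb _ (by omega))
  · refine (Set.finite_Icc b (n - b)).subset ?_
    rintro p ⟨hp, hp'⟩
    refine ⟨?_, ?_⟩
    · by_contra hlt
      exact hp (hb _ (by omega))
    · by_contra hlt
      exact hp' (hb _ (by omega))

/-- The image in `E^* ⊗ E^*` of the restriction of `f ∘ μ` to `Eᵖ ⊗ E^q`. -/
theorem exists_comul_component (hE : E.IsLocallyFinite) (f : E.carrier →ₗ[k] k) (p q : ℤ) :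
    ∃ t ∈ LinearMap.range (TensorProduct.mapIncl (E.gradedDualGr (-p)) (E.gradedDualGr (-q))),
      ∀ a b, E.dualPairing t (a ⊗ₜ b) =
        f (gradedProj E.gr_internal p a * gradedProj E.gr_internal q b) := by
  have := hE p
  have := hE q
  let β : Module.Dual k (E.gr p ⊗[k] E.gr q) :=
    f ∘ₗ LinearMap.mul' k E.carrier ∘ₗ TensorProduct.mapIncl (E.gr p) (E.gr q)
  let e := (TensorProduct.dualDistribEquiv k (E.gr p) (E.gr q)).symm β
  refine ⟨TensorProduct.map (E.dualExt p) (E.dualExt q) e, ?_, ?_⟩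
  · generalize e = t
    induction t with
    | zero => simp
    | add x y hx hy => rw [map_add]; exact add_mem hx hy
    | tmul x y =>
      exact ⟨⟨_, E.dualExt_mem p x⟩ ⊗ₜ ⟨_, E.dualExt_mem q y⟩, rfl⟩
  · intro a b
    have h : ∀ t, E.dualPairing (TensorProduct.map (E.dualExt p) (E.dualExt q) t) (a ⊗ₜ b) =
        TensorProduct.dualDistribEquiv k (E.gr p) (E.gr q) t
          (gradedProj E.gr_internal p a ⊗ₜ gradedProj E.gr_internal q b) := by
      intro t
      induction t with
      | zero => simp
      | add x y hx hy => simp only [map_add, LinearMap.add_apply, hx, hy]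
      | tmul x y =>
        rw [TensorProduct.map_tmul, dualPairing_tmul, dualExt_apply, dualExt_apply]
        rfl
    rw [h, LinearEquiv.apply_symm_apply]
    rfl

theorem exists_comul (hE : E.IsRaylike) (n : ℤ) (f : E.carrier →ₗ[k] k)
    (hf : f ∈ E.dualGr n) :
    ∃ t ∈ ⨆ p : ℤ, LinearMap.range
      (TensorProduct.mapIncl (E.gradedDualGr p) (E.gradedDualGr (n - p))),
      ∀ a b, E.dualPairing t (a ⊗ₜ b) = f (a * b) := by
  classical
  choose T hT hT' using E.exists_comul_component hE.1 f
  let S := (hE.finite (-n)).toFinset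
  refine ⟨∑ p ∈ S, T p (-n - p), ?_, ?_⟩
  · refine sum_mem fun p _ => Submodule.mem_iSup_of_mem (-p) ?_
    have := hT p (-n - p)
    rwa [show -(-n - p) = n - -p by ring] at this
  · intro a b
    rw [map_sum, LinearMap.sum_apply]
    simp only [hT']
    induction a using graded_induction E.gr_internal with
    | h0 => simp
    | hadd x y hx hy => simp only [map_add, add_mul, Submodule.coe_add, Finset.sum_add_distrib, hx, hy]
    | hmem i a ha =>
      induction b using graded_induction E.gr_internal with
      | h0 => simp
      | hadd x y hx hy =>
        simp only [map_add, mul_add, Submodule.coe_add, Finset.sum_add_distrib, hx, hy]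
      | hmem j b hb =>
        rw [Finset.sum_eq_single i]
        · rw [gradedProj_same _ ha]
          by_cases hj : j = -n - i
          · subst hj
            rw [gradedProj_same _ hb]
          · rw [gradedProj_ne _ hj hb, hf (i + j) (by omega) _ (E.mul_mem i j a b ha hb)]
            simp
        · intro p _ hp
          rw [gradedProj_ne _ hp.symm ha]
          simp
        · intro hi
          rw [Set.Finite.mem_toFinset, Set.mem_ofPred_eq, not_and_or, not_not, not_not] at hi
          rcases hi with hi | hi
          · rw [gradedProj_same _ ha]
            rw [hi, Submodule.mem_bot] at ha
            simp [ha]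
          · by_cases hj : j = -n - i
            · subst hj
              rw [gradedProj_same _ hb]
              rw [hi, Submodule.mem_bot] at hb
              simp [hb]
            · rw [gradedProj_ne _ hj hb]
              simp

theorem comul_mem_range (hE : E.IsRaylike) (f : E.GradedDual) :
    E.dualIncl f ∘ₗ LinearMap.mul' k E.carrier ∈ LinearMap.range E.dualPairing := by
  induction f using E.gradedDual_induction with
  | h0 => simp
  | hadd x y hx hy => rw [map_add, LinearMap.add_comp]; exact add_mem hx hy
  | hmem n x hx =>
    obtain ⟨t, -, ht⟩ := E.exists_comul hE n (E.dualIncl x) hx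
    exact ⟨t, TensorProduct.ext' fun a b => by simp [ht]⟩

/-- The comultiplication of `E^*`: the transpose `E^* → (E ⊗ E)^*` of the multiplication of `E`,
which takes values in the subspace `E^* ⊗ E^*` since `E` is raylike. -/
noncomputable def dualComul (hE : E.IsRaylike) : E.GradedDual →ₗ[k] E.GradedDual ⊗[k] E.GradedDual :=
  (LinearEquiv.ofInjective E.dualPairing E.dualPairing_injective).symm.toLinearMap ∘ₗ
    (LinearMap.lcomp k k (LinearMap.mul' k E.carrier) ∘ₗ E.dualIncl).codRestrict _
      (E.comul_mem_range hE)

theorem dualPairing_dualComul (hE : E.IsRaylike) (f : E.GradedDual) (a b : E.carrier) :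
    E.dualPairing (E.dualComul hE f) (a ⊗ₜ b) = E.dualIncl f (a * b) := by
  have : E.dualPairing (E.dualComul hE f) = E.dualIncl f ∘ₗ LinearMap.mul' k E.carrier := by
    have := (LinearEquiv.ofInjective E.dualPairing E.dualPairing_injective).apply_symm_apply
      ((LinearMap.lcomp k k (LinearMap.mul' k E.carrier) ∘ₗ E.dualIncl).codRestrict _
      (E.comul_mem_range hE) f)
    exact congrArg Subtype.val this
  rw [this]
  simp

/-- The counital coalgebra `E^*`; the counit is evaluation at `1`. -/
@[reducible]
noncomputable def dualCoalgebra (hE : E.IsRaylike) : Coalgebra k E.GradedDual where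
  comul := E.dualComul hE
  counit := E.dualEval 1
  coassoc := coassoc_of_eval E.dualEval E.dualEval_ext _ fun f a b => by
    rw [← dualPairing_eq, dualPairing_dualComul, dualEval_apply]
  rTensor_counit_comp_comul := by
    refine LinearMap.ext fun f => (TensorProduct.lid k E.GradedDual).injective ?_
    refine sub_eq_zero.mp (E.dualEval_ext _ fun a => ?_)
    rw [map_sub, sub_eq_zero, LinearMap.comp_apply, dualEval_rTensor, dualPairing_dualComul]
    simp [dualEval_apply]
  lTensor_counit_comp_comul := by
    refine LinearMap.ext fun f => (TensorProduct.rid k E.GradedDual).injective ?_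
    refine sub_eq_zero.mp (E.dualEval_ext _ fun a => ?_)
    rw [map_sub, sub_eq_zero, LinearMap.comp_apply, dualEval_lTensor, dualPairing_dualComul]
    simp [dualEval_apply]

theorem dualComul_mem (hE : E.IsRaylike) (n : ℤ) (f : E.GradedDual) (hf : f ∈ E.gradedDualGr n) :
    E.dualComul hE f ∈ ⨆ p : ℤ, LinearMap.range
      (TensorProduct.mapIncl (E.gradedDualGr p) (E.gradedDualGr (n - p))) := by
  obtain ⟨t, ht, ht'⟩ := E.exists_comul hE n (E.dualIncl f) hf
  have : E.dualComul hE f = t := E.dualPairing_ext fun a b => by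
    rw [dualPairing_dualComul, ht']
  rwa [this]

theorem dualSign_apply (f : E.GradedDual) (a : E.carrier) :
    E.dualIncl (gradedSign E.gradedDualGr_internal f) a = E.dualIncl f (gradedSign E.gr_internal a) := by
  induction f using E.gradedDual_induction with
  | h0 => simp
  | hadd x y hx hy => simp [hx, hy]
  | hmem n f hf =>
    rw [gradedSign_of_mem E.gradedDualGr_internal hf]
    induction a using graded_induction E.gr_internal with
    | h0 => simp
    | hadd x y hx hy => simp only [map_add, hx, hy]
    | hmem i a ha =>
      rw [gradedSign_of_mem E.gr_internal ha]
      by_cases hi : i = -n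
      · subst hi
        have e : (-1 : k) ^ (-n) = (-1) ^ n := by
          rw [zpow_neg]
          exact inv_eq_of_mul_eq_one_left (neg_one_zpow_mul_self n)
        simp [e]
      · have : E.dualIncl f a = 0 := hf i hi a ha
        simp [this]

theorem dualComul_d (hE : E.IsRaylike) (f : E.GradedDual) :
    E.dualComul hE (E.dualD f) = TensorProduct.map E.dualD LinearMap.id (E.dualComul hE f) +
      TensorProduct.map (gradedSign E.gradedDualGr_internal) E.dualD (E.dualComul hE f) := by
  refine E.dualPairing_ext fun a b => ?_
  have h1 : ∀ t, E.dualPairing (TensorProduct.map E.dualD LinearMap.id t) (a ⊗ₜ b) =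
      E.dualPairing t (E.d a ⊗ₜ b) := by
    intro t
    induction t with
    | zero => simp
    | add x y hx hy => simp only [map_add, LinearMap.add_apply, hx, hy]
    | tmul x y => rw [TensorProduct.map_tmul, dualPairing_tmul, dualPairing_tmul]; rfl
  have h2 : ∀ t, E.dualPairing (TensorProduct.map (gradedSign E.gradedDualGr_internal) E.dualD t)
      (a ⊗ₜ b) = E.dualPairing t (gradedSign E.gr_internal a ⊗ₜ E.d b) := by
    intro t
    induction t with
    | zero => simp
    | add x y hx hy => simp only [map_add, LinearMap.add_apply, hx, hy]
    | tmul x y =>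
      rw [TensorProduct.map_tmul, dualPairing_tmul, dualPairing_tmul, dualSign_apply]; rfl
  rw [map_add, LinearMap.add_apply, h1, h2]
  simp only [dualPairing_dualComul]
  rw [← map_add]
  change E.dualIncl f (E.d (a * b)) = _
  congr 1
  clear h1 h2
  induction a using graded_induction E.gr_internal with
  | h0 => simp
  | hadd x y hx hy => simp only [map_add, add_mul, hx, hy]; abel
  | hmem i a ha => rw [E.leibniz i a b ha, gradedSign_of_mem _ ha, smul_mul_assoc]

/-- The coaugmented dg coalgebra `E^*` dual to a raylike augmented dg algebra `E`. Its coaugmentation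
is dual to the augmentation of `E`. -/
noncomputable def dual (hE : E.IsRaylike) : CoaugDGC.{u, max u v} k where
  carrier := E.GradedDual
  coalgebra := E.dualCoalgebra hE
  gr := E.gradedDualGr
  gr_internal := E.gradedDualGr_internal
  counit_gr i hi f hf := hf 0 (by simpa [eq_comm] using hi) 1 E.one_mem
  comul_gr := E.dualComul_mem hE
  d := E.dualD
  d_mem n f hf := E.d_comp_mem n (E.dualIncl f) hf
  d_d f := Subtype.ext (LinearMap.ext fun a => by
    change E.dualIncl f (E.d (E.d a)) = 0
    rw [E.d_d, map_zero])
  counit_d f := by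
    change E.dualIncl f (E.d 1) = 0
    have := E.leibniz 0 1 1 E.one_mem
    have h : E.d 1 = 0 := by simpa using this
    rw [h, map_zero]
  comul_d := E.dualComul_d hE
  unit := E.dualUnit
  unit_mem := E.aug_mem_dualGr
  counit_unit := map_one E.aug
  comul_unit := E.dualPairing_ext fun a b => by
    change E.dualPairing (E.dualComul hE _) _ = _
    rw [dualPairing_dualComul, dualPairing_tmul]
    exact map_mul E.aug a b
  d_unit := Subtype.ext (LinearMap.ext fun a => E.aug_d a)

end AugDGA

end CobarCompletion

/-! Because `E` is 1-coconnective, the coaugmentation coideal of `E^*` sits in negative degrees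
(`IsOneCoconnective.eq_zero_of_mem_dual_coideal`). Hence the graded algebra `A` underlying the cobar
construction is free on generators of degree at most `0` (`exists_wordBasis_cobar`). The powers of
`𝔪` are then spanned by long words (`augPow_eq`). As `A¹ = 0`, letters of degree `0` are cocycles,
so nilpotence of `H⁰` makes every word of `N` such letters a coboundary (`exists_d_eq_basis`).

The heart is that, for each `j`, the inclusion of a suitable power of `𝔪` into `A` is null-homotopic
in degrees above `-j` (`exists_isContraction`). The homotopy `H` is moreover left `A`-linear up to
sign on words of length at least `M`. It is built by induction on `j`. The defect `δ = 1 - dH - Hd`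
is a chain map, is left linear on long words, and vanishes on them above degree `-j`. Let `pq` be a
word of degree `-j` with `p` of length `N` and `q` of length `M`. Then `δ(pq) = p δ(q)`, which is
zero unless `p` has degree `0`; in that case `p = dc` and `δ(pq) = d(c δ(q))`. Correcting `H` by
these primitives on the last `N + M` letters of a word, and extending linearly, kills the defect in
degree `-j` (`exists_succ`).

By linearity `H` only rewrites the last `M` letters of a long word, so it shortens words by a
bounded amount and makes sense on the completion (`IsContraction.mem_filt`). Its defect annihilates
long words in the relevant degrees, so it turns an element of the completion into an honest element
of `A`. The two maps show that completion is bijective on cohomology in each degree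
(`quasiIso_completionMap`). -/

namespace CobarCompletion

/-! ### Graded algebras that are free on generators of non-positive degree -/

/-- A basis of an augmented dg algebra consisting of the words in a set `B` of homogeneous
generators, which have non-positive degrees and lie in the augmentation ideal. In other words, the
underlying graded augmented algebra is free on `B`. -/
structure WordBasis {k : Type u} [Field k] (A : AugDGA.{u, v} k) (B : Type w) where
  /-- the basis of words -/
  basis : Module.Basis (List B) k A.carrier
  /-- the degrees of the generators -/
  deg : B → ℤ
  deg_nonpos : ∀ x, deg x ≤ 0
  basis_nil : basis [] = 1
  basis_cons : ∀ x l, basis (x :: l) = basis [x] * basis l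
  basis_singleton_mem : ∀ x, basis [x] ∈ A.gr (deg x)
  aug_basis_singleton : ∀ x, A.aug (basis [x]) = 0

namespace WordBasis

variable {k : Type u} [Field k] {A : AugDGA.{u, v} k} {B : Type w} (b : WordBasis A B)

/-- The degree of a word. -/
def wdeg (l : List B) : ℤ := (l.map b.deg).sum

theorem wdeg_append (l m : List B) : b.wdeg (l ++ m) = b.wdeg l + b.wdeg m := by
  simp [wdeg]

theorem wdeg_nonpos (l : List B) : b.wdeg l ≤ 0 := by
  induction l with
  | nil => simp [wdeg]
  | cons x l ih =>
    have := b.deg_nonpos x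
    simp only [wdeg, List.map_cons, List.sum_cons] at ih ⊢
    omega

theorem basis_append (l m : List B) : b.basis (l ++ m) = b.basis l * b.basis m := by
  induction l with
  | nil => simp [b.basis_nil]
  | cons x l ih => rw [List.cons_append, b.basis_cons, b.basis_cons x l, ih, mul_assoc]

theorem basis_mem (l : List B) : b.basis l ∈ A.gr (b.wdeg l) := by
  induction l with
  | nil => rw [b.basis_nil]; exact A.one_mem
  | cons x l ih =>
    rw [b.basis_cons]
    simpa [wdeg] using A.mul_mem _ _ _ _ (b.basis_singleton_mem x) ih

theorem basis_induction {P : A.carrier → Prop} (zero : P 0) (add : ∀ x y, P x → P y → P (x + y))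
    (smul : ∀ (r : k) x, P x → P (r • x)) (basis : ∀ l, P (b.basis l)) (x : A.carrier) : P x := by
  have hx : x ∈ Submodule.span k (Set.range b.basis) := b.basis.mem_span x
  induction hx using Submodule.span_induction with
  | zero => exact zero
  | add x y _ _ hx hy => exact add x y hx hy
  | smul r x _ hx => exact smul r x hx
  | mem x hx => obtain ⟨l, rfl⟩ := hx; exact basis l

/-- Projection to degree `i` fixes the words of degree `i` and kills all others. This reduces
statements about homogeneous elements to words. -/
theorem mem_gr_iff {i : ℤ} {x : A.carrier} :
    x ∈ A.gr i ↔ x ∈ Submodule.span k (b.basis '' {l | b.wdeg l = i}) := by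
  constructor
  · intro hx
    have key : ∀ y : A.carrier, (gradedProj A.gr_internal i y : A.carrier) ∈
        Submodule.span k (b.basis '' {l | b.wdeg l = i}) := by
      intro y
      induction y using b.basis_induction with
      | zero => simp
      | add x y hx hy => rw [map_add]; exact add_mem hx hy
      | smul r x hx => rw [map_smul]; exact Submodule.smul_mem _ r hx
      | basis l =>
        by_cases hl : b.wdeg l = i
        · rw [gradedProj_same _ (hl ▸ b.basis_mem l)]
          exact Submodule.subset_span ⟨l, hl, rfl⟩
        · rw [gradedProj_ne _ hl (b.basis_mem l)]
          simp
    simpa [gradedProj_same _ hx] using key x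
  · intro hx
    refine (Submodule.span_le.mpr ?_) hx
    rintro _ ⟨l, rfl, rfl⟩
    exact b.basis_mem l

/-! ### The word-length filtration and the powers of the augmentation ideal -/

/-- The span of the words of length at least `n`. -/
def filt (n : ℕ) : Submodule k A.carrier := Submodule.span k (b.basis '' {l | n ≤ l.length})

theorem basis_mem_filt {n : ℕ} {l : List B} (h : n ≤ l.length) : b.basis l ∈ b.filt n :=
  Submodule.subset_span ⟨l, h, rfl⟩

theorem filt_anti {m n : ℕ} (h : m ≤ n) : b.filt n ≤ b.filt m :=
  Submodule.span_mono (Set.image_mono fun _ hl => h.trans hl)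

theorem filt_zero : b.filt 0 = ⊤ := by
  simp [filt, b.basis.span_eq]

/-- A homogeneous element of `filt n` is a combination of words of the same degree of length at
least `n`. -/
theorem mem_span_of_mem_filt {n : ℕ} {i : ℤ} {x : A.carrier} (hx : x ∈ b.filt n)
    (hi : x ∈ A.gr i) :
    x ∈ Submodule.span k (b.basis '' {l | n ≤ l.length ∧ b.wdeg l = i}) := by
  rw [b.mem_gr_iff, b.basis.mem_span_image] at hi
  rw [filt, b.basis.mem_span_image] at hx
  rw [b.basis.mem_span_image]
  exact fun l hl => ⟨hx hl, hi hl⟩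

theorem mul_mem_filt {m n : ℕ} {x y : A.carrier} (hx : x ∈ b.filt m) (hy : y ∈ b.filt n) :
    x * y ∈ b.filt (m + n) := by
  have : b.filt m * b.filt n ≤ b.filt (m + n) := by
    rw [filt, filt, Submodule.span_mul_span, Submodule.span_le]
    rintro _ ⟨_, ⟨l, hl, rfl⟩, _, ⟨l', hl', rfl⟩, rfl⟩
    change b.basis l * b.basis l' ∈ _
    rw [← b.basis_append]
    refine b.basis_mem_filt ?_
    rw [List.length_append]
    exact add_le_add hl hl'
  exact this (Submodule.mul_mem_mul hx hy)

/-- The augmentation is multiplicative and kills letters, so it kills nonempty words; the empty word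
is `1`. Thus `x - ε(x)` always lies in the span of the nonempty words. -/
theorem ker_aug : LinearMap.ker A.aug.toLinearMap = b.filt 1 := by
  have aug_cons : ∀ x l, A.aug (b.basis (x :: l)) = 0 := fun x l => by
    rw [b.basis_cons, map_mul, b.aug_basis_singleton, zero_mul]
  have hx : ∀ x : A.carrier, x - algebraMap k _ (A.aug x) ∈ b.filt 1 := by
    intro x
    induction x using b.basis_induction with
    | zero => simp
    | add x y hx hy =>
      rw [map_add, map_add, add_sub_add_comm]
      exact add_mem hx hy
    | smul r x hx =>
      have : r • x - algebraMap k _ (A.aug (r • x)) = r • (x - algebraMap k _ (A.aug x)) := by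
        rw [map_smul, smul_sub, smul_eq_mul, map_mul, Algebra.smul_def, Algebra.smul_def]
      rw [this]
      exact Submodule.smul_mem _ r hx
    | basis l =>
      cases l with
      | nil => simp [b.basis_nil]
      | cons x l =>
        rw [aug_cons, map_zero, sub_zero]
        exact b.basis_mem_filt (by simp)
  apply le_antisymm
  · intro x h
    have h' : A.aug x = 0 := h
    simpa [h'] using hx x
  · refine Submodule.span_le.mpr ?_
    rintro _ ⟨l, hl, rfl⟩
    cases l with
    | nil => simp at hl
    | cons x l => exact aug_cons x l

/-- The `𝔪`-adic filtration is the word-length filtration: a long word splits off its first letter,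
which lies in `𝔪`. The shift is there because `augPow n` is `𝔪ⁿ⁺¹`. -/
theorem augPow_eq (n : ℕ) : A.augPow n = b.filt (n + 1) := by
  rw [AugDGA.augPow, b.ker_aug]
  apply le_antisymm
  · induction n with
    | zero => simp
    | succ n ih =>
      rw [pow_succ, Submodule.mul_le]
      exact fun x hx y hy => b.mul_mem_filt (ih hx) hy
  · refine Submodule.span_le.mpr ?_
    rintro _ ⟨l, hl, rfl⟩
    induction n generalizing l with
    | zero => rw [zero_add, pow_one]; exact b.basis_mem_filt hl
    | succ n ih =>
      cases l with
      | nil => simp at hl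
      | cons x l =>
        rw [b.basis_cons, pow_succ']
        exact Submodule.mul_mem_mul (b.basis_mem_filt (by simp)) (ih l (by simpa using hl))

theorem d_mem_filt {n : ℕ} {x : A.carrier} (hx : x ∈ b.filt n) : A.d x ∈ b.filt n := by
  cases n with
  | zero => rw [b.filt_zero]; trivial
  | succ n =>
    rw [← b.augPow_eq] at hx ⊢
    exact A.d_mem_augPow n x hx

theorem gr_eq_bot (b : WordBasis A B) {i : ℤ} (hi : 0 < i) : A.gr i = ⊥ := by
  rw [eq_bot_iff]
  intro x hx
  rw [b.mem_gr_iff] at hx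
  refine (Submodule.span_le.mpr ?_) hx
  rintro _ ⟨l, hl, rfl⟩
  have h : b.wdeg l = i := hl
  have := b.wdeg_nonpos l
  omega

/-! ### Left-linear maps prescribed on suffixes of fixed length -/

/-- The map that sends a word `p ++ s` with `s` of length `M` to `(-1) ^ |p| * p * g s`, and shorter
words to zero. -/
noncomputable def suffixMap (M : ℕ) (g : List B → A.carrier) : A.carrier →ₗ[k] A.carrier :=
  b.basis.constr k fun l => if M ≤ l.length then
    (-1 : k) ^ b.wdeg (l.take (l.length - M)) •
      (b.basis (l.take (l.length - M)) * g (l.drop (l.length - M))) else 0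

theorem suffixMap_append {M : ℕ} (g : List B → A.carrier) (p : List B) {s : List B}
    (hs : s.length = M) :
    b.suffixMap M g (b.basis (p ++ s)) = (-1 : k) ^ b.wdeg p • (b.basis p * g s) := by
  subst hs
  simp [suffixMap, Module.Basis.constr_basis]

theorem exists_append_of_le {M : ℕ} {l : List B} (h : M ≤ l.length) :
    ∃ p s, l = p ++ s ∧ s.length = M ∧ p.length = l.length - M :=
  ⟨l.take (l.length - M), l.drop (l.length - M), by simp, by simp; omega, by simp⟩

/-- Left multiplication by `a` only lengthens the prefix. The words of `x` need at least `M`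
letters, since otherwise `a` would reach into the suffix of length `M`. -/
theorem suffixMap_mul {M : ℕ} (g : List B → A.carrier) {i : ℤ} {a x : A.carrier}
    (ha : a ∈ A.gr i) (hx : x ∈ b.filt M) :
    b.suffixMap M g (a * x) = (-1 : k) ^ i • (a * b.suffixMap M g x) := by
  rw [b.mem_gr_iff] at ha
  induction ha using Submodule.span_induction with
  | zero => simp
  | add x y _ _ hx hy => simp [add_mul, hx, hy]
  | smul r x _ hx => simp [hx, smul_comm r]
  | mem a ha =>
    obtain ⟨q, rfl, rfl⟩ := ha
    induction hx using Submodule.span_induction with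
    | zero => simp
    | add x y _ _ hx hy => simp [mul_add, hx, hy]
    | smul r x _ hx => simp [hx, smul_comm r]
    | mem x hx =>
      obtain ⟨l, hl, rfl⟩ := hx
      obtain ⟨p, s, rfl, hs, -⟩ := exists_append_of_le hl
      rw [← b.basis_append, ← List.append_assoc, b.suffixMap_append g _ hs,
        b.suffixMap_append g _ hs, b.wdeg_append, zpow_add₀ (by simp), b.basis_append, mul_assoc,
        mul_smul_comm, smul_smul]

theorem suffixMap_mem {M : ℕ} {g : List B → A.carrier} (hg : ∀ s, g s ∈ A.gr (b.wdeg s - 1))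
    {i : ℤ} {x : A.carrier} (hx : x ∈ A.gr i) : b.suffixMap M g x ∈ A.gr (i - 1) := by
  rw [b.mem_gr_iff] at hx
  induction hx using Submodule.span_induction with
  | zero => simp
  | add x y _ _ hx hy => rw [map_add]; exact add_mem hx hy
  | smul r x _ hx => rw [map_smul]; exact Submodule.smul_mem _ r hx
  | mem x hx =>
    obtain ⟨l, rfl, rfl⟩ := hx
    by_cases hl : M ≤ l.length
    · obtain ⟨p, s, rfl, hs, -⟩ := exists_append_of_le hl
      rw [b.suffixMap_append g _ hs, b.wdeg_append, add_sub_assoc]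
      exact Submodule.smul_mem _ _ (A.mul_mem _ _ _ _ (b.basis_mem p) (hg s))
    · rw [suffixMap, Module.Basis.constr_basis, if_neg hl]
      exact zero_mem _

/-- Prefixes have non-positive degree, so a suffix has at least the degree of the whole word. -/
theorem suffixMap_eq_zero {M : ℕ} {g : List B → A.carrier} {j : ℤ}
    (hg : ∀ s, j < b.wdeg s → g s = 0) {i : ℤ} (hi : j < i) {x : A.carrier} (hx : x ∈ A.gr i) :
    b.suffixMap M g x = 0 := by
  rw [b.mem_gr_iff] at hx
  induction hx using Submodule.span_induction with
  | zero => simp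
  | add x y _ _ hx hy => rw [map_add, hx, hy, add_zero]
  | smul r x _ hx => rw [map_smul, hx, smul_zero]
  | mem x hx =>
    obtain ⟨l, rfl, rfl⟩ := hx
    by_cases hl : M ≤ l.length
    · obtain ⟨p, s, rfl, hs, -⟩ := exists_append_of_le hl
      rw [b.suffixMap_append g _ hs, hg s, mul_zero, smul_zero]
      rw [b.wdeg_append] at hi
      have := b.wdeg_nonpos p
      omega
    · rw [suffixMap, Module.Basis.constr_basis, if_neg hl]

/-! ### Contracting homotopies on long words -/

/-- `H` is linear over `A`, up to the Koszul sign, on words of length at least `M`, and contracts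
them in degrees greater than `-j`. -/
structure IsContraction (H : A.carrier →ₗ[k] A.carrier) (M j : ℕ) : Prop where
  mem : ∀ i, ∀ x ∈ A.gr i, H x ∈ A.gr (i - 1)
  mul : ∀ i, ∀ a ∈ A.gr i, ∀ x ∈ b.filt M, H (a * x) = (-1 : k) ^ i • (a * H x)
  homotopy : ∀ i, -(j : ℤ) < i → ∀ x ∈ A.gr i, x ∈ b.filt M → A.d (H x) + H (A.d x) = x

/-- `A` vanishes in positive degrees, so there is nothing to contract. -/
theorem IsContraction.zero : b.IsContraction 0 0 0 where
  mem i x _ := by simp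
  mul i a _ x _ := by simp
  homotopy i hi x hx _ := by
    rw [b.gr_eq_bot (by simpa using hi), Submodule.mem_bot] at hx
    simp [hx]

/-- The difference of the identity and the boundary of `H`. -/
def defect (H : A.carrier →ₗ[k] A.carrier) : A.carrier →ₗ[k] A.carrier :=
  LinearMap.id - A.d ∘ₗ H - H ∘ₗ A.d

theorem defect_apply (H : A.carrier →ₗ[k] A.carrier) (x : A.carrier) :
    defect H x = x - A.d (H x) - H (A.d x) := rfl

theorem d_defect (H : A.carrier →ₗ[k] A.carrier) (x : A.carrier) :
    A.d (defect H x) = defect H (A.d x) := by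
  simp [defect_apply, A.d_d]

namespace IsContraction

variable {b} {H : A.carrier →ₗ[k] A.carrier} {M j : ℕ}

theorem defect_eq_zero (h : b.IsContraction H M j) {i : ℤ} (hi : -(j : ℤ) < i) {x : A.carrier}
    (hx : x ∈ A.gr i) (hx' : x ∈ b.filt M) : defect H x = 0 := by
  rw [defect_apply, sub_sub, h.homotopy i hi x hx hx', sub_self]

/-- The terms `da * H x` coming from `dH` and from `Hd` have opposite signs and cancel. The Koszul
signs on the remaining terms square to `1`. -/
theorem defect_mul (h : b.IsContraction H M j) {i : ℤ} {a x : A.carrier} (ha : a ∈ A.gr i)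
    (hx : x ∈ b.filt M) : defect H (a * x) = a * defect H x := by
  simp only [defect_apply]
  rw [h.mul i a ha x hx, A.leibniz i a x ha, map_add, map_smul, map_smul, A.leibniz i _ _ ha,
    h.mul _ _ (A.d_mem i a ha) x hx, h.mul i a ha _ (b.d_mem_filt hx), neg_one_zpow_succ]
  simp only [smul_add, smul_smul, neg_one_zpow_mul_self, one_smul, mul_sub, neg_smul]
  abel

theorem defect_mem (h : b.IsContraction H M j) {i : ℤ} {x : A.carrier} (hx : x ∈ A.gr i) :
    defect H x ∈ A.gr i := by
  have h1 := A.d_mem _ _ (h.mem i x hx)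
  have h2 := h.mem _ _ (A.d_mem i x hx)
  rw [sub_add_cancel] at h1
  rw [add_sub_cancel_right] at h2
  exact sub_mem (sub_mem hx h1) h2

/-- By linearity `H` alters only the last `M` letters, so the prefix of length at least `n`
survives. This is continuity of `H` for the `𝔪`-adic topology. -/
theorem mem_filt (h : b.IsContraction H M j) {n : ℕ} {x : A.carrier} (hx : x ∈ b.filt (n + M)) :
    H x ∈ b.filt n := by
  induction hx using Submodule.span_induction with
  | zero => simp
  | add x y _ _ hx hy => rw [map_add]; exact add_mem hx hy
  | smul r x _ hx => rw [map_smul]; exact Submodule.smul_mem _ r hx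
  | mem x hx =>
    obtain ⟨l, hl, rfl⟩ := hx
    have hl : n + M ≤ l.length := hl
    obtain ⟨p, s, rfl, hs, hp⟩ := exists_append_of_le (M := M) (l := l) (by omega)
    rw [b.basis_append, h.mul _ _ (b.basis_mem p) _ (b.basis_mem_filt hs.ge)]
    refine Submodule.smul_mem _ _ ?_
    have := b.mul_mem_filt (n := 0) (b.basis_mem_filt (n := n) (l := p) (by omega))
      (y := H (b.basis s)) (by rw [b.filt_zero]; trivial)
    simpa using this

/-- If long words of degree zero are coboundaries, then the defect of a contraction has coboundaries
as values on sufficiently long words of degree `-j`. -/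
theorem exists_d_eq_defect (h : b.IsContraction H M j) {N : ℕ}
    (hN : ∀ p : List B, p.length = N → b.wdeg p = 0 → ∃ c ∈ A.gr (-1), A.d c = b.basis p)
    (s : List B) (hs : s.length = N + M) (hs' : b.wdeg s = -j) :
    ∃ c ∈ A.gr (b.wdeg s - 1), A.d c = defect H (b.basis s) := by
  obtain ⟨p, q, rfl, hq, hp⟩ := exists_append_of_le (M := M) (l := s) (by omega)
  rw [b.wdeg_append] at hs'
  have hq' := b.basis_mem_filt (n := M) hq.ge
  rw [b.basis_append, h.defect_mul (b.basis_mem p) hq']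
  have := b.wdeg_nonpos p
  -- The degrees of `p` and `q` are non-positive with sum `-j`: either `q` lies above degree `-j`,
  -- where the defect vanishes, or `p` has degree `0`.
  by_cases hqj : -(j : ℤ) < b.wdeg q
  · exact ⟨0, zero_mem _, by simp [h.defect_eq_zero hqj (b.basis_mem q) hq']⟩
  · have hp0 : b.wdeg p = 0 := by omega
    obtain ⟨c, hc, hc'⟩ := hN p (by omega) hp0
    -- In `d (c * δ q) = p * δ q - c * d (δ q)` the last term is zero: `d (δ q) = δ (d q)`, and `d
    -- q` is a combination of long words of degree above `-j`.
    refine ⟨c * defect H (b.basis q), ?_, ?_⟩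
    · have := A.mul_mem _ _ _ _ hc (h.defect_mem (b.basis_mem q))
      rwa [b.wdeg_append, hp0, zero_add, sub_eq_add_neg, add_comm]
    · rw [A.leibniz _ _ _ hc, hc', d_defect,
        h.defect_eq_zero (by omega) (A.d_mem _ _ (b.basis_mem q)) (b.d_mem_filt hq')]
      simp

/-- The correction subtracts a primitive of the defect on each word of length `N + M` and degree
`-j`. It is then extended left linearly to longer words, so checking suffixes of exactly that length
suffices. -/
theorem exists_succ (h : b.IsContraction H M j) {N : ℕ}
    (hN : ∀ p : List B, p.length = N → b.wdeg p = 0 → ∃ c ∈ A.gr (-1), A.d c = b.basis p) :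
    ∃ H', b.IsContraction H' (N + M) (j + 1) := by
  classical
  -- The primitive is set to zero on words of any other degree, so that the correction leaves `H`
  -- unchanged above degree `-j`.
  have hex : ∀ s : List B, ∃ c ∈ A.gr (b.wdeg s - 1), (b.wdeg s ≠ -j → c = 0) ∧
      (s.length = N + M → b.wdeg s = -j → A.d c = defect H (b.basis s)) := by
    intro s
    by_cases hs : s.length = N + M ∧ b.wdeg s = -j
    · obtain ⟨c, hc, hc'⟩ := h.exists_d_eq_defect hN s hs.1 hs.2
      exact ⟨c, hc, fun hn => absurd hs.2 hn, fun _ _ => hc'⟩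
    · exact ⟨0, zero_mem _, fun _ => rfl, fun h1 h2 => absurd ⟨h1, h2⟩ hs⟩
  choose g hg hg0 hgd using hex
  have hle : b.filt (N + M) ≤ b.filt M := b.filt_anti (by omega)
  let H' := H + b.suffixMap (N + M) g
  have hH' : ∀ x, H' x = H x + b.suffixMap (N + M) g x := fun _ => rfl
  have hz : ∀ i : ℤ, -(j : ℤ) < i → ∀ x ∈ A.gr i, b.suffixMap (N + M) g x = 0 :=
    fun i hi x hx => b.suffixMap_eq_zero (fun s hs => hg0 s (by omega)) hi hx
  have hmul : ∀ i, ∀ a ∈ A.gr i, ∀ x ∈ b.filt (N + M), H' (a * x) = (-1 : k) ^ i • (a * H' x) := by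
    intro i a ha x hx
    rw [hH', hH', h.mul i a ha x (hle hx), b.suffixMap_mul g ha hx, mul_add, smul_add]
  refine ⟨H', fun i x hx => add_mem (h.mem i x hx) (b.suffixMap_mem hg hx), hmul, ?_⟩
  have key : ∀ i : ℤ, -(j : ℤ) ≤ i → ∀ x ∈ A.gr i, x ∈ b.filt (N + M) → defect H' x = 0 := by
    intro i hi x hx hx'
    rcases hi.lt_or_eq with hi | rfl
    · have := h.defect_eq_zero hi hx (hle hx')
      rw [defect_apply] at this ⊢
      rw [hH', hH', hz i hi x hx, hz _ (by omega) _ (A.d_mem i x hx), add_zero, add_zero, this]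
    · have hx'' := b.mem_span_of_mem_filt hx' hx
      clear hx hx'
      induction hx'' using Submodule.span_induction with
      | zero => simp
      | add x y _ _ hx hy => rw [map_add, hx, hy, add_zero]
      | smul r x _ hx => rw [map_smul, hx, smul_zero]
      | mem x hx =>
        obtain ⟨l, ⟨hl, hl'⟩, rfl⟩ := hx
        obtain ⟨p, s, rfl, hs, -⟩ := exists_append_of_le hl
        rw [b.wdeg_append] at hl'
        have hp := b.wdeg_nonpos p
        have hss := b.basis_mem s
        have hmem := b.basis_mem_filt hs.ge
        -- The prefix has non-positive degree, so `s` has degree at least `-j` and `d s` lies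
        -- strictly above, where the correction vanishes.
        have hds := hz _ (by omega) _ (A.d_mem _ _ hss)
        have hsm : b.suffixMap (N + M) g (b.basis s) = g s := by
          simpa [wdeg, b.basis_nil] using b.suffixMap_append g [] hs
        have hdef : defect H' (b.basis s) = defect H (b.basis s) - A.d (g s) := by
          rw [defect_apply, defect_apply, hH', hH', hds, hsm, map_add]
          abel
        have hzero : defect H' (b.basis s) = 0 := by
          rw [hdef]
          by_cases hsj : b.wdeg s = -j
          · rw [hgd s hs hsj, sub_self]
          · rw [hg0 s hsj, map_zero, sub_zero]
            exact h.defect_eq_zero (by omega) hss (hle hmem)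
        -- `defect_mul` uses only the degree and linearity of `H'`. Level `0` supplies the remaining
        -- field for free, as it concerns positive degrees only.
        have hmul' : defect H' (b.basis p * b.basis s) = b.basis p * defect H' (b.basis s) :=
          defect_mul (b := b) (j := 0) (M := N + M) ⟨fun i x hx =>
            add_mem (h.mem i x hx) (b.suffixMap_mem hg hx), hmul, fun i hi x hx _ => by
              rw [b.gr_eq_bot (by simpa using hi), Submodule.mem_bot] at hx
              simp [hx]⟩ (b.basis_mem p) hmem
        rw [b.basis_append, hmul', hzero, mul_zero]
  intro i hi x hx hx'
  have := key i (by push_cast at hi; omega) x hx hx'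
  rw [defect_apply, sub_sub, sub_eq_zero] at this
  exact this.symm

end IsContraction

/-- Each step adds `N` to the required word length, so `M` depends on `j`. This is harmless because
cohomology is compared one degree at a time. -/
theorem exists_isContraction {N : ℕ}
    (hN : ∀ p : List B, p.length = N → b.wdeg p = 0 → ∃ c ∈ A.gr (-1), A.d c = b.basis p)
    (j : ℕ) : ∃ H M, b.IsContraction H M j := by
  induction j with
  | zero => exact ⟨0, 0, IsContraction.zero b⟩
  | succ j ih =>
    obtain ⟨H, M, h⟩ := ih
    obtain ⟨H', h'⟩ := h.exists_succ hN
    exact ⟨H', N + M, h'⟩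

/-- If `H⁰(A)` is nilpotent, then long words of degree zero are coboundaries. -/
theorem exists_d_eq_basis (hnil : A.IsH₀Nilpotent) : ∃ N : ℕ, ∀ p : List B, p.length = N →
    b.wdeg p = 0 → ∃ c ∈ A.gr (-1), A.d c = b.basis p := by
  obtain ⟨N, hN⟩ := hnil
  refine ⟨N, fun p hp hp0 => ?_⟩
  have hd : ∀ p : List B, b.wdeg p = 0 → b.basis p ∈ A.cocycles₀ := by
    intro p hp0
    have h := b.basis_mem p
    rw [hp0] at h
    refine ⟨h, ?_⟩
    have := A.d_mem 0 _ h
    rwa [b.gr_eq_bot (by norm_num), Submodule.mem_bot] at this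
  have key : ∀ (n : ℕ) (p : List B) (_ : p.length = n) (h0 : b.wdeg p = 0),
      Ideal.Quotient.mk A.coboundaries₀ ⟨b.basis p, hd p h0⟩ ∈
        (LinearMap.ker A.H₀aug.toLinearMap) ^ n := by
    intro n
    induction n with
    | zero =>
      intro p hp h0
      obtain rfl := List.length_eq_zero_iff.mp hp
      rw [pow_zero]
      have : (⟨b.basis [], hd _ h0⟩ : A.cocycles₀) = 1 := Subtype.ext b.basis_nil
      rw [this, map_one]
      exact Submodule.one_le.mp le_rfl
    | succ n ih =>
      intro p hp h0
      cases p with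
      | nil => simp at hp
      | cons x l =>
        have hx := b.deg_nonpos x
        have hl := b.wdeg_nonpos l
        have hxl : b.wdeg (x :: l) = b.wdeg [x] + b.wdeg l := b.wdeg_append [x] l
        have hx' : b.wdeg [x] = b.deg x := by simp [wdeg]
        -- Non-positive degrees with sum zero are all zero.
        have hx0 : b.wdeg [x] = 0 := by omega
        have hl0 : b.wdeg l = 0 := by omega
        have : (⟨b.basis (x :: l), hd _ h0⟩ : A.cocycles₀) =
            ⟨b.basis [x], hd _ hx0⟩ * ⟨b.basis l, hd _ hl0⟩ := Subtype.ext (b.basis_cons x l)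
        rw [this, map_mul, pow_succ']
        refine Submodule.mul_mem_mul ?_ (ih l (by simpa using hp) hl0)
        exact b.aug_basis_singleton x
  have h := key N p hp hp0
  rw [hN, Submodule.mem_bot, Ideal.Quotient.eq_zero_iff_mem] at h
  exact h

end WordBasis

/-! ### Quasi-isomorphisms in terms of elements -/

/-- A morphism of short complexes of modules which is bijective on homology, in terms of elements,
is a quasi-isomorphism. -/
theorem shortComplex_quasiIso_of_elements {R : Type u} [Ring R]
    {S T : ShortComplex (ModuleCat.{v} R)} (φ : S ⟶ T)
    (hinj : ∀ (x : S.X₂) (y : T.X₁), S.g x = 0 → φ.τ₂ x = T.f y → ∃ z, S.f z = x)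
    (hsurj : ∀ y : T.X₂, T.g y = 0 → ∃ x z, S.g x = 0 ∧ y = φ.τ₂ x + T.f z) :
    ShortComplex.QuasiIso φ := by
  let φK : LinearMap.ker S.g.hom →ₗ[R] LinearMap.ker T.g.hom :=
    φ.τ₂.hom.restrict fun x hx => by
      have h := LinearMap.congr_fun (ModuleCat.hom_ext_iff.mp φ.comm₂₃) x
      simp only [ModuleCat.hom_comp, LinearMap.comp_apply] at h
      rw [LinearMap.mem_ker] at hx ⊢
      rw [h, hx, map_zero]
  have hφ : LinearMap.range S.moduleCatToCycles ≤
      (LinearMap.range T.moduleCatToCycles).comap φK := by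
    rintro _ ⟨x, rfl⟩
    refine ⟨φ.τ₁ x, Subtype.ext ?_⟩
    exact LinearMap.congr_fun (ModuleCat.hom_ext_iff.mp φ.comm₁₂) x
  -- Homology is modelled as cycles modulo boundaries, where the induced map is a `Submodule.mapQ`.
  let γ : ShortComplex.LeftHomologyMapData φ S.moduleCatLeftHomologyData
      T.moduleCatLeftHomologyData :=
    { φK := ModuleCat.ofHom φK
      φH := ModuleCat.ofHom (Submodule.mapQ _ _ φK hφ)
      commi := rfl
      commf' := by
        ext x
        exact Subtype.ext (LinearMap.congr_fun (ModuleCat.hom_ext_iff.mp φ.comm₁₂) x).symm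
      commπ := rfl }
  rw [γ.quasiIso_iff, ConcreteCategory.isIso_iff_bijective]
  change Function.Bijective (Submodule.mapQ _ _ φK hφ)
  constructor
  · rw [← LinearMap.ker_eq_bot, LinearMap.ker_eq_bot']
    intro x hx
    obtain ⟨⟨x, hx'⟩, rfl⟩ := Submodule.mkQ_surjective _ x
    rw [Submodule.mkQ_apply, Submodule.mapQ_apply, Submodule.Quotient.mk_eq_zero] at hx
    obtain ⟨y, hy⟩ := hx
    obtain ⟨z, hz⟩ := hinj x y hx' (congrArg Subtype.val hy).symm
    rw [Submodule.mkQ_apply, Submodule.Quotient.mk_eq_zero]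
    exact ⟨z, Subtype.ext hz⟩
  · intro y
    obtain ⟨⟨y, hy⟩, rfl⟩ := Submodule.mkQ_surjective _ y
    obtain ⟨x, z, hx, hxz⟩ := hsurj y hy
    refine ⟨Submodule.Quotient.mk ⟨x, hx⟩, ?_⟩
    rw [Submodule.mapQ_apply, Submodule.mkQ_apply, eq_comm, Submodule.Quotient.eq]
    refine ⟨z, Subtype.ext ?_⟩
    change T.f z = y - φ.τ₂ x
    rw [hxz, add_sub_cancel_left]

/-- The degrees are free variables tied by equations, so that no transport along `j - 1 + 1 = j` is
needed when applying it. -/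
theorem quasiIso_of_elements {R : Type u} [Ring R] {K L : CochainComplex (ModuleCat.{v} R) ℤ}
    (φ : K ⟶ L)
    (hinj : ∀ i j l, i + 1 = j → j + 1 = l → ∀ (x : K.X j) (y : L.X i), K.d j l x = 0 →
      φ.f j x = L.d i j y → ∃ z, K.d i j z = x)
    (hsurj : ∀ i j l, i + 1 = j → j + 1 = l → ∀ y : L.X j, L.d j l y = 0 →
      ∃ x z, K.d j l x = 0 ∧ y = φ.f j x + L.d i j z) :
    QuasiIso φ := by
  refine ⟨fun j => ?_⟩
  rw [quasiIsoAt_iff' φ (j - 1) j (j + 1) (by simp) (by simp)]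
  exact shortComplex_quasiIso_of_elements _ (hinj _ _ _ (by ring) rfl) (hsurj _ _ _ (by ring) rfl)

/-! ### Elements of the completion -/

namespace AugDGA

variable {k : Type u} [Field k] (A : AugDGA.{u, v} k)

theorem complex_d {i j : ℤ} (h : i + 1 = j) (x : A.gr i) :
    A.complex.d i j x = A.dRes i j h x := by
  simp only [complex, dif_pos h]
  rfl

theorem completion_d {i j : ℤ} (h : i + 1 = j) (x : A.completionGr i) :
    A.completion.d i j x = A.completionD i j h x := by
  simp only [completion, dif_pos h]
  rfl

theorem quotMk_eq_iff {n : ℕ} {i : ℤ} {x y : A.gr i} :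
    A.quotMk n i x = A.quotMk n i y ↔ (x : A.carrier) - y ∈ A.augPow n :=
  Submodule.Quotient.eq _

theorem augPow_anti : Antitone A.augPow := antitone_nat_of_succ_le A.augPow_succ_le

/-- Representatives of the components of an element of the completion. -/
theorem exists_lift {i : ℤ} (y : A.completionGr i) : ∃ r : ℕ → A.gr i,
    (∀ n, A.quotMk n i (r n) = y.1 n) ∧
      ∀ m n, m ≤ n → (r n : A.carrier) - r m ∈ A.augPow m := by
  choose r hr using fun n => A.quotMk_surjective n i (y.1 n)
  refine ⟨r, hr, fun m n hmn => ?_⟩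
  -- Consecutive representatives differ by an element of `𝔪ⁿ⁺¹`; the differences telescope.
  induction n, hmn using Nat.le_induction with
  | base => simp
  | succ n hmn ih =>
    have h : A.quotMk n i (r (n + 1)) = A.quotMk n i (r n) := by
      rw [hr n, ← y.2 n, ← hr (n + 1)]
      rfl
    have := add_mem (A.augPow_anti hmn (A.quotMk_eq_iff.mp h)) ih
    simpa using this

end AugDGA

/-! ### The completion map is a quasi-isomorphism -/

namespace WordBasis

variable {k : Type u} [Field k] {A : AugDGA.{u, v} k} {B : Type w} (b : WordBasis A B)

/-- For injectivity, a cocycle that bounds in the completion is a coboundary plus a cocycle on long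
words, and `H` bounds the latter. For surjectivity, the defect of `H` replaces a cocycle of the
completion by a cohomologous one coming from `A`. -/
theorem quasiIso_completionMap (b : WordBasis A B) (hnil : A.IsH₀Nilpotent) : QuasiIso A.completionMap := by
  obtain ⟨N, hN⟩ := b.exists_d_eq_basis hnil
  apply quasiIso_of_elements
  · intro i j l hij hjl (x : A.gr j) (y : A.completionGr i) hx hxy
    -- This level puts degree `j` strictly inside the contracted range; truncation at `0` for large
    -- `j` does no harm.
    obtain ⟨H, M, h⟩ := b.exists_isContraction hN (-j + 1).toNat
    rw [A.complex_d hjl] at hx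
    have hx : A.d x = 0 := congrArg Subtype.val hx
    rw [A.completion_d hij] at hxy
    obtain ⟨r, hr, -⟩ := A.exists_lift y
    have hxr : A.quotMk M j x = A.quotMk M j (A.dRes i j hij (r M)) := by
      have : A.quotMk M j x = A.quotD M i j hij (y.1 M) :=
        congrFun (congrArg Subtype.val hxy) M
      rw [this, ← hr]
      rfl
    rw [A.quotMk_eq_iff, b.augPow_eq] at hxr
    have hmem : (x : A.carrier) - A.d (r M) ∈ A.gr j :=
      sub_mem x.2 (hij ▸ A.d_mem i _ (r M).2)
    have key := h.homotopy j (by omega) _ hmem (b.filt_anti (by omega) hxr)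
    rw [map_sub A.d (x : A.carrier), hx, A.d_d, sub_zero, map_zero, add_zero] at key
    have hz := h.mem j _ hmem
    rw [show j - 1 = i by omega] at hz
    -- `x - d (r M)` is a cocycle on long words, hence equals `d` of its image under `H`.
    let z : A.gr i := r M + ⟨_, hz⟩
    refine ⟨z, ?_⟩
    rw [A.complex_d hij]
    apply Subtype.ext
    change A.d (r M + H (x - A.d (r M))) = x
    rw [map_add, key, add_sub_cancel]
  · intro i j l hij hjl (y : A.completionGr j) hy
    obtain ⟨H, M, h⟩ := b.exists_isContraction hN (-j + 1).toNat
    rw [A.completion_d hjl] at hy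
    obtain ⟨r, hr, hrr⟩ := A.exists_lift y
    have hdr : ∀ n, A.d (r n) ∈ b.filt (n + 1) := by
      intro n
      have h0 : A.quotMk n l (A.dRes j l hjl (r n)) = A.quotMk n l 0 := by
        have : A.quotD n j l hjl (y.1 n) = 0 := congrFun (congrArg Subtype.val hy) n
        rw [← hr] at this
        rw [map_zero]
        exact this
      rw [A.quotMk_eq_iff, b.augPow_eq] at h0
      rwa [ZeroMemClass.coe_zero, sub_zero] at h0
    have hdl : ∀ n, A.d (r n) ∈ A.gr l := fun n => hjl ▸ A.d_mem j _ (r n).2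
    -- The defect kills long words in degrees `j` and `j + 1`. So `x` is a cocycle, and later
    -- representatives of `y` yield the same `x`.
    let x : A.gr j := ⟨defect H (r M), h.defect_mem (r M).2⟩
    have hx : A.d x = 0 := by
      change A.d (defect H (r M)) = 0
      rw [d_defect, h.defect_eq_zero (by omega) (hdl M) (b.filt_anti (by omega) (hdr M))]
    have hHmem : ∀ n, H (r n) ∈ A.gr i := fun n => by
      have := h.mem j _ (r n).2
      rwa [show j - 1 = i by omega] at this
    have hxn : ∀ n, defect H (r (n + M)) = x := by
      intro n
      rw [← sub_eq_zero]
      change _ - defect H (r M) = 0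
      rw [← map_sub]
      have := hrr M (n + M) (by omega)
      rw [b.augPow_eq] at this
      exact h.defect_eq_zero (by omega) (sub_mem (r _).2 (r _).2) (b.filt_anti (by omega) this)
    -- `z` is `H` applied to `y`. The index is shifted by `M` because `H` can shorten words by `M`
    -- letters.
    let z : A.completionGr i := ⟨fun n => A.quotMk n i ⟨H (r (n + M)), hHmem _⟩, fun n => by
      change A.quotMk n i _ = _
      rw [A.quotMk_eq_iff, b.augPow_eq]
      change H _ - H _ ∈ _
      rw [← map_sub]
      refine h.mem_filt ?_
      have := hrr (n + M) (n + 1 + M) (by omega)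
      rw [b.augPow_eq] at this
      exact b.filt_anti (by omega) this⟩
    refine ⟨x, z, ?_, ?_⟩
    · rw [A.complex_d hjl]
      exact Subtype.ext hx
    · rw [A.completion_d hij]
      apply Subtype.ext
      funext n
      change y.1 n = A.quotMk n j x + A.quotMk n j (A.dRes i j hij ⟨H (r (n + M)), hHmem _⟩)
      rw [← map_add, ← hr, A.quotMk_eq_iff, b.augPow_eq]
      change (r n : A.carrier) - (x + A.d (H (r (n + M)))) ∈ _
      have h1 := hrr n (n + M) (by omega)
      rw [b.augPow_eq] at h1
      have h2 : H (A.d (r (n + M))) ∈ b.filt (n + 1) :=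
        h.mem_filt (b.filt_anti (by omega) (hdr (n + M)))
      -- This is `r = δ r + d (H r) + H (d r)` for `r = r (n + M)`, with `δ r = x`; both terms on
      -- the right are combinations of words longer than `n`.
      have : (r n : A.carrier) - (x + A.d (H (r (n + M)))) =
          H (A.d (r (n + M))) - (r (n + M) - r n) := by
        rw [← hxn n, defect_apply]
        abel
      rw [this]
      exact sub_mem h2 h1

end WordBasis

/-! ### The word basis of the cobar construction -/

namespace CoaugDGC

variable {k : Type u} [Field k] (C : CoaugDGC.{u, v} k)

/-- The projection `toBar` preserves degrees and restricts to the identity on the coideal. This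
allows a basis of homogeneous elements to be extracted. -/
theorem span_homogeneous_coideal :
    ⊤ ≤ Submodule.span k {c : C.coideal | ∃ i, (c : C.carrier) ∈ C.gr i} := by
  rintro c -
  have key : ∀ x : C.carrier,
      C.toBar x ∈ Submodule.span k {c : C.coideal | ∃ i, (c : C.carrier) ∈ C.gr i} := by
    intro x
    induction x using graded_induction C.gr_internal with
    | h0 => simp
    | hadd x y hx hy => rw [map_add]; exact add_mem hx hy
    | hmem i x hx => exact Submodule.subset_span ⟨i, C.toBar_mem hx⟩
  simpa [C.toBar_coe] using key c

/-- If `C̄` is concentrated in negative degrees, then `Ω(C)` has a basis of words in generators of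
non-positive degree. -/
theorem exists_wordBasis_cobar
    (hC : ∀ i : ℤ, 0 ≤ i → ∀ c : C.coideal, (c : C.carrier) ∈ C.gr i → c = 0) :
    ∃ B : Type v, Nonempty (WordBasis C.cobar B) := by
  let e := Module.Basis.ofSpan C.span_homogeneous_coideal
  have he : ∀ x, ∃ i, (e x : C.carrier) ∈ C.gr i := fun x =>
    Module.Basis.ofSpan_subset C.span_homogeneous_coideal ⟨x, rfl⟩
  choose deg hdeg using he
  -- The monomial basis of the free algebra, carried over to the tensor algebra, consists of the
  -- products of the `C.ι (e x)`.
  have hb : ∀ w, e.tensorAlgebra w = FreeMonoid.lift (C.ι ∘ e) w := by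
    intro w
    change (TensorAlgebra.equivFreeAlgebra e).symm
      (MonoidAlgebra.lift k (FreeAlgebra k _) _ (FreeMonoid.lift (FreeAlgebra.ι k))
        (MonoidAlgebra.single w 1)) = _
    rw [MonoidAlgebra.lift_single, one_smul]
    induction w using FreeMonoid.inductionOn' with
    | one => simp
    | of_mul x w ih => simp [ih]
  let w : Module.Basis (List _) k C.CobarAlg := e.tensorAlgebra.reindex FreeMonoid.toList
  have hw : ∀ l, w l = FreeMonoid.lift (C.ι ∘ e) (FreeMonoid.ofList l) := fun l => by
    rw [Module.Basis.reindex_apply, FreeMonoid.toList_symm, hb]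
  have hs : ∀ x, w [x] = C.ι (e x) := fun x => by
    rw [hw, FreeMonoid.ofList_singleton, FreeMonoid.lift_eval_of]
    rfl
  exact ⟨_, ⟨{
    basis := w
    deg := fun x => deg x + 1
    -- A basis vector is nonzero, so its degree is negative; desuspension raises it by one.
    deg_nonpos := fun x => by
      by_contra hx
      exact e.ne_zero x (hC (deg x) (by omega) _ (hdeg x))
    basis_nil := (hw []).trans (map_one _)
    basis_cons := fun x l => by
      change w (x :: l) = w [x] * w l
      rw [hw, hw, hw, ← map_mul]
      rfl
    basis_singleton_mem := fun x => by
      change w [x] ∈ C.cobarGr _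
      rw [hs]
      exact C.ι_mem_cobarGr (hdeg x)
    aug_basis_singleton := fun x => by
      change TensorAlgebra.algebraMapInv (w [x]) = 0
      rw [hs]
      simp [TensorAlgebra.algebraMapInv] }⟩⟩

end CoaugDGC

/-! ### The coaugmentation coideal of the dual -/

namespace AugDGA

variable {k : Type u} [Field k] {E : AugDGA.{u, v} k}

/-- A functional of degree `i` lives on `E⁻ⁱ`. This space is zero for `i > 0`; for `i = 0` it is
spanned by `1`, on which the coideal vanishes because the counit is evaluation at `1`. -/
theorem IsOneCoconnective.eq_zero_of_mem_dual_coideal (h₁ : E.IsOneCoconnective)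
    (hE : E.IsRaylike) (i : ℤ) (hi : 0 ≤ i) (c : (E.dual hE).coideal)
    (hc : (c : (E.dual hE).carrier) ∈ (E.dual hE).gr i) : c = 0 := by
  obtain ⟨f, hf⟩ := c
  have hf1 : E.dualIncl f 1 = 0 := hf
  have hc : ∀ j, j ≠ -i → ∀ a ∈ E.gr j, E.dualIncl f a = 0 := hc
  obtain ⟨h₁, ⟨φ⟩⟩ := h₁
  -- The augmentation rules out `1 = 0`, so `1` spans the one-dimensional space `E⁰`.
  have h0 : (1 : E.carrier) ≠ 0 := fun h => by
    have := map_one E.aug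
    rw [h, map_zero] at this
    exact zero_ne_one this
  refine Subtype.ext (E.dualEval_ext f fun a => ?_)
  change E.dualIncl f a = 0
  induction a using graded_induction E.gr_internal with
  | h0 => simp
  | hadd x y hx hy => rw [map_add, hx, hy, add_zero]
  | hmem j a ha =>
    by_cases hj : j = -i
    · rcases hi.eq_or_lt with rfl | hi
      · obtain rfl : j = 0 := by omega
        let one : E.gr 0 := ⟨1, E.one_mem⟩
        have hφ : φ one ≠ 0 := fun h =>
          h0 (congrArg Subtype.val ((map_eq_zero_iff φ φ.injective).mp h))
        have : (⟨a, ha⟩ : E.gr 0) = (φ ⟨a, ha⟩ / φ one) • one := by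
          apply φ.injective
          rw [map_smul, smul_eq_mul, div_mul_cancel₀ _ hφ]
        have : a = (φ ⟨a, ha⟩ / φ one) • (1 : E.carrier) := congrArg Subtype.val this
        rw [this, map_smul, hf1, smul_zero]
      · rw [h₁ j (by omega), Submodule.mem_bot] at ha
        rw [ha, map_zero]
    · exact hc j hj a ha

end AugDGA

end CobarCompletion

theorem mainTheorem10 {k : Type u} [Field k] (E : CobarCompletion.AugDGA.{u, v} k)
    (h₁ : E.IsOneCoconnective) (h₂ : E.IsLocallyFinite)
    (hnil : (E.dual (h₁.isRaylike h₂)).cobar.IsH₀Nilpotent) :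
    QuasiIso (E.dual (h₁.isRaylike h₂)).cobarCompletionMap := by
  obtain ⟨B, ⟨b⟩⟩ := (E.dual (h₁.isRaylike h₂)).exists_wordBasis_cobar
    (h₁.eq_zero_of_mem_dual_coideal (h₁.isRaylike h₂))
  exact b.quasiIso_completionMap hnil
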